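/- **Setting.** All systems are finite dimensional with fixed orthonormal bases. A state is a positive semi-definite operator of trace one; a channel is a completely positive trace-preserving linear map. For channels $\mathcal N,\mathcal M$ from $C$ to $D$ let $$\|\mathcal N-\mathcal M\|_\diamond=\sup_{\rho_{RC}}\|(\mathrm{id}_R\otimes\mathcal N)(\rho_{RC})-(\mathrm{id}_R\otimes\mathcal M)(\rho_{RC})\|_1,\qquad F(\mathcal N,\mathcal M)=\inf_{\rho_{RC}}F\big((\mathrm{id}_R\otimes\mathcal N)(\rho_{RC}),(\mathrm{id}_R\otimes\mathcal M)(\rho_{RC})\big),$$ over all finite-dimensional reference systems $R$ and all states $\rho_{RC}$, where $\|X\|_1=\operatorname{Tr}\sqrt{X^\dagger X}$ and $F(\omega,\tau)=\|\sqrt\omega\sqrt\tau\|_1^2$. For a set $S$ of parties, $T_S$ is the partial transpose on all systems held by the parties in $S$ (with respect to the fixed bases). A multipartite channel $\mathcal P$, in which each party holds one input and one output system (possibly composite or trivial), is *completely PPT preserving* (C-PPT-P) if $T_{S}\circ\mathcal P\circ T_S$ is completely positive for every set $S$ of parties, where the left $T_S$ acts on the outputs and the right one on the inputs. For a multipartite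 channel $\mathcal N$ with joint input $A$ and a state $\rho$ shared by the same parties on joint system $\hat A$, define $$e_{\mathrm{PPT}}(\mathcal N,\rho)=\inf_{\mathcal P}\tfrac12\|\mathcal N-\widetilde{\mathcal N}_{\mathcal P}\|_\diamond,\qquad e^F_{\mathrm{PPT}}(\mathcal N,\rho)=\inf_{\mathcal P}\big(1-F(\mathcal N,\widetilde{\mathcal N}_{\mathcal P})\big),\qquad \widetilde{\mathcal N}_{\mathcal P}(\omega)=\mathcal P(\omega\otimes\rho),$$ where the infima are over all C-PPT-P channels $\mathcal P$ whose input at each party consists of that party's input to $\mathcal N$ and its share of $\rho$, and whose output at each party is that of $\mathcal N$. **Proposition.** Let $d\ge 2$, let $A,B$ be $d$-dimensional systems, let $\mathcal S^d_{AB}(\omega)=F_{AB}\,\omega\, F_{AB}^\dagger$ with $F_{AB}=\sum_{i,j}|i\rangle\langle j|_A\otimes|j\rangle\langle i|_B$ be the swap channel, regarded as a three-party channel in which Alice holds $A$, Bob holds $B$, and Charlie has trivial (one-dimensional) input and output, and let $\rho_{\hat A\hat B\hat C}$ be a state shared by Alice ($\hat A$), Bob ($\hat B$) and Charlie ($\hat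 C$), of arbitrary finite local dimensions. Then $$e_{\mathrm{PPT}}(\mathcal S^d_{AB},\rho_{\hat A\hat B\hat C})=e^F_{\mathrm{PPT}}(\mathcal S^d_{AB},\rho_{\hat A\hat B\hat C})=1-\sup_{K,L,M,N}\operatorname{Tr}[\rho_{\hat A\hat B\hat C}K],$$ where the supremum is over all operators $K,L,M,N\ge0$ on $\hat A\hat B\hat C$ such that $K+L+M+N=I$, $$T_{\hat C}(K),\;T_{\hat C}(L),\;T_{\hat C}(M),\;T_{\hat C}(N)\ge0,$$ and, for each $\hat S\in\{\hat A,\hat B\}$, $$T_{\hat S}\Big(K+\tfrac{L}{d+1}+\tfrac{M}{d+1}+\tfrac{N}{(d+1)^2}\Big)\ge0,$$ $$\tfrac1{d-1}T_{\hat S}\Big(L+\tfrac{N}{d+1}\Big)\ge T_{\hat S}\Big(K+\tfrac{M}{d+1}\Big),\qquad \tfrac1{d-1}T_{\hat S}\Big(M+\tfrac{N}{d+1}\Big)\ge T_{\hat S}\Big(K+\tfrac{L}{d+1}\Big),$$ $$T_{\hat S}\Big(K+\tfrac{N}{(d-1)^2}\Big)\ge\tfrac1{d-1}T_{\hat S}(L+M).$$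 -/

import Mathlib

open scoped ComplexOrder MatrixOrder

noncomputable section

namespace QChannel

/-! ### States and maps. A finite-dimensional system is a finite type, which labels its standard
basis; operators on it are square complex matrices indexed by that type. -/

/-- A quantum state (density operator): positive semi-definite with trace one. -/
def IsState {X : Type*} [Fintype X] (ρ : Matrix X X ℂ) : Prop :=
  ρ.PosSemidef ∧ ρ.trace = 1

/-- The action of `id_R ⊗ Φ` on operators on the composite system `R × C`. -/
def ampliate {C D : Type*} (R : Type*) (Φ : Matrix C C ℂ →ₗ[ℂ] Matrix D D ℂ)
    (X : Matrix (R × C) (R × C) ℂ) : Matrix (R × D) (R × D) ℂ :=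
  Matrix.of fun p q => Φ (Matrix.of fun c c' => X (p.1, c) (q.1, c')) p.2 q.2

/-- Complete positivity: `id_R ⊗ Φ` is positive for every finite-dimensional `R`. -/
def IsCP {C D : Type*} (Φ : Matrix C C ℂ →ₗ[ℂ] Matrix D D ℂ) : Prop :=
  ∀ (n : ℕ) (X : Matrix (Fin n × C) (Fin n × C) ℂ), X.PosSemidef → (ampliate (Fin n) Φ X).PosSemidef

/-- A quantum channel: a completely positive trace-preserving linear map. -/
def IsChannel {C D : Type*} [Fintype C] [Fintype D] (Φ : Matrix C C ℂ →ₗ[ℂ] Matrix D D ℂ) : Prop :=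
  IsCP Φ ∧ ∀ X, (Φ X).trace = X.trace

/-! ### Distance measures -/

/-- The trace norm `‖X‖₁ = Tr |X|`, where `|X| = √(X† X)`. -/
def traceNorm {X : Type*} [Fintype X] [DecidableEq X] (M : Matrix X X ℂ) : ℝ :=
  (CFC.abs M).trace.re

/-- The (squared, Uhlmann) fidelity `F(ω, τ) = ‖√ω √τ‖₁²`. -/
def fidelity {X : Type*} [Fintype X] [DecidableEq X] (ω τ : Matrix X X ℂ) : ℝ :=
  traceNorm (CFC.sqrt ω * CFC.sqrt τ) ^ 2

/-- The diamond distance of two channels: the supremum, over all finite-dimensional reference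
systems `R` and all states `ρ` of `R C`, of `‖(id ⊗ N)(ρ) - (id ⊗ M)(ρ)‖₁`. -/
def diamondDist {C D : Type*} [Fintype C] [Fintype D] [DecidableEq D]
    (N M : Matrix C C ℂ →ₗ[ℂ] Matrix D D ℂ) : ℝ :=
  sSup {t : ℝ | ∃ (n : ℕ) (ρ : Matrix (Fin n × C) (Fin n × C) ℂ), IsState ρ ∧
    t = traceNorm (ampliate (Fin n) N ρ - ampliate (Fin n) M ρ)}

/-- The channel fidelity: the infimum, over all finite-dimensional reference systems `R` and all
states `ρ` of `R C`, of `F((id ⊗ N)(ρ), (id ⊗ M)(ρ))`. -/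
def channelFidelity {C D : Type*} [Fintype C] [Fintype D] [DecidableEq D]
    (N M : Matrix C C ℂ →ₗ[ℂ] Matrix D D ℂ) : ℝ :=
  sInf {t : ℝ | ∃ (n : ℕ) (ρ : Matrix (Fin n × C) (Fin n × C) ℂ), IsState ρ ∧
    t = fidelity (ampliate (Fin n) N ρ) (ampliate (Fin n) M ρ)}

/-! ### Multipartite systems. Party `i` of the finite set `ι` of parties holds the system `A i`;
the standard basis of the joint system is labelled by `∀ i, A i`. -/

section Multipartite

variable {ι : Type*} [Fintype ι] [DecidableEq ι]

/-- The partial transpose `T_S` on the systems of the parties in `S`: it exchanges the `S`-parts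
of the row and the column label. -/
def partialTranspose {A : ι → Type*} (S : Finset ι) :
    Matrix (∀ i, A i) (∀ i, A i) ℂ →ₗ[ℂ] Matrix (∀ i, A i) (∀ i, A i) ℂ where
  toFun X := Matrix.of fun x y => X (S.piecewise y x) (S.piecewise x y)
  map_add' _ _ := by ext; simp
  map_smul' _ _ := by ext; simp

/-- A multipartite channel `P` is completely PPT preserving if `T_{S'} ∘ P ∘ T_S` is completely
positive for every set `S` of parties. -/
def IsCPPTP {A A' : ι → Type*} [∀ i, Fintype (A i)] [∀ i, Fintype (A' i)]
    (P : Matrix (∀ i, A i) (∀ i, A i) ℂ →ₗ[ℂ] Matrix (∀ i, A' i) (∀ i, A' i) ℂ) : Prop :=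
  IsChannel P ∧
    ∀ S : Finset ι, IsCP (partialTranspose S ∘ₗ P ∘ₗ partialTranspose S)

/-- `ω ↦ ω ⊗ ρ`, where party `i` then holds the two systems `A i` and `R i`. -/
def tensorResource {A R : ι → Type*} (ρ : Matrix (∀ i, R i) (∀ i, R i) ℂ) :
    Matrix (∀ i, A i) (∀ i, A i) ℂ →ₗ[ℂ] Matrix (∀ i, A i × R i) (∀ i, A i × R i) ℂ where
  toFun ω := Matrix.of fun x y =>
    ω (fun i => (x i).1) (fun i => (y i).1) * ρ (fun i => (x i).2) (fun i => (y i).2)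
  map_add' _ _ := by ext; simp [add_mul]
  map_smul' _ _ := by ext; simp [mul_assoc]

variable {A A' R : ι → Type*} [∀ i, Fintype (A i)] [∀ i, Fintype (A' i)] [∀ i, DecidableEq (A' i)]
  [∀ i, Fintype (R i)]

/-- The PPT simulation error of the multipartite channel `N` with resource state `ρ`, measured by
the normalized diamond distance. -/
def pptError (N : Matrix (∀ i, A i) (∀ i, A i) ℂ →ₗ[ℂ] Matrix (∀ i, A' i) (∀ i, A' i) ℂ)
    (ρ : Matrix (∀ i, R i) (∀ i, R i) ℂ) : ℝ :=
  sInf {e : ℝ | ∃ P : Matrix (∀ i, A i × R i) (∀ i, A i × R i) ℂ →ₗ[ℂ]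
      Matrix (∀ i, A' i) (∀ i, A' i) ℂ,
    IsCPPTP P ∧ e = 1 / 2 * diamondDist N (P ∘ₗ tensorResource ρ)}

/-- The PPT simulation error of the multipartite channel `N` with resource state `ρ`, measured by
the channel infidelity. -/
def pptErrorF (N : Matrix (∀ i, A i) (∀ i, A i) ℂ →ₗ[ℂ] Matrix (∀ i, A' i) (∀ i, A' i) ℂ)
    (ρ : Matrix (∀ i, R i) (∀ i, R i) ℂ) : ℝ :=
  sInf {e : ℝ | ∃ P : Matrix (∀ i, A i × R i) (∀ i, A i × R i) ℂ →ₗ[ℂ]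
      Matrix (∀ i, A' i) (∀ i, A' i) ℂ,
    IsCPPTP P ∧ e = 1 - channelFidelity N (P ∘ₗ tensorResource ρ)}

end Multipartite

/-! ### Bidirectional controlled teleportation -/

/-- The three parties. -/
inductive Party where
  | alice
  | bob
  | charlie
  deriving DecidableEq

instance : Fintype Party where
  elems := {.alice, .bob, .charlie}
  complete := by intro p; cases p <;> decide

/-- Dimensions of the systems on which the swap channel acts, for input and output alike: Alice
and Bob hold a `d`-dimensional system each, and Charlie a trivial one. -/
def swapDim (d : ℕ) : Party → ℕ
  | .alice => d
  | .bob => d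
  | .charlie => 1

/-- The system of a party on which the swap channel acts. -/
abbrev SwapSys (d : ℕ) (p : Party) : Type := Fin (swapDim d p)

/-- Exchange of the labels of Alice and Bob. -/
def flipLabel (d : ℕ) (x : ∀ p, SwapSys d p) : ∀ p, SwapSys d p
  | .alice => x .bob
  | .bob => x .alice
  | .charlie => x .charlie

/-- The swap operator `F = ∑ i j, |i⟩⟨j|_A ⊗ |j⟩⟨i|_B`. -/
def swapOp (d : ℕ) : Matrix (∀ p, SwapSys d p) (∀ p, SwapSys d p) ℂ :=
  Matrix.of fun x y => if x = flipLabel d y then 1 else 0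

/-- The unitary swap channel `ω ↦ F ω F†`. -/
def swapChannel (d : ℕ) : Matrix (∀ p, SwapSys d p) (∀ p, SwapSys d p) ℂ →ₗ[ℂ]
    Matrix (∀ p, SwapSys d p) (∀ p, SwapSys d p) ℂ where
  toFun ω := swapOp d * ω * (swapOp d).conjTranspose
  map_add' _ _ := by simp [Matrix.mul_add, Matrix.add_mul]
  map_smul' _ _ := by simp

/-- The constraints of the semi-definite program on the operators `K, L, M, N` on the resource
systems. Inequalities are in the Loewner order. -/
structure SwapFeasible (d : ℕ) {R : Party → Type*} [∀ p, Fintype (R p)] [∀ p, DecidableEq (R p)]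
    (K L M N : Matrix (∀ p, R p) (∀ p, R p) ℂ) : Prop where
  nonneg_K : 0 ≤ K
  nonneg_L : 0 ≤ L
  nonneg_M : 0 ≤ M
  nonneg_N : 0 ≤ N
  sum_eq_one : K + L + M + N = 1
  ppt_one : ∀ p ∈ ({.alice, .bob} : Set Party), 0 ≤ partialTranspose {p}
    (K + (1 / ((d : ℝ) + 1)) • L + (1 / ((d : ℝ) + 1)) • M + (1 / ((d : ℝ) + 1) ^ 2) • N)
  ppt_two : ∀ p ∈ ({.alice, .bob} : Set Party),
    partialTranspose {p} (K + (1 / ((d : ℝ) + 1)) • M) ≤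
      (1 / ((d : ℝ) - 1)) • partialTranspose {p} (L + (1 / ((d : ℝ) + 1)) • N)
  ppt_three : ∀ p ∈ ({.alice, .bob} : Set Party),
    partialTranspose {p} (K + (1 / ((d : ℝ) + 1)) • L) ≤
      (1 / ((d : ℝ) - 1)) • partialTranspose {p} (M + (1 / ((d : ℝ) + 1)) • N)
  ppt_four : ∀ p ∈ ({.alice, .bob} : Set Party),
    (1 / ((d : ℝ) - 1)) • partialTranspose {p} (L + M) ≤
      partialTranspose {p} (K + (1 / ((d : ℝ) - 1) ^ 2) • N)
  ppt_charlie_K : 0 ≤ partialTranspose {Party.charlie} K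
  ppt_charlie_L : 0 ≤ partialTranspose {Party.charlie} L
  ppt_charlie_M : 0 ≤ partialTranspose {Party.charlie} M
  ppt_charlie_N : 0 ≤ partialTranspose {Party.charlie} N

end QChannel

end

open QChannel

/-!
The Choi matrix of the swap channel is a product of two maximally entangled operators, one on
Alice's input and Bob's output and one on Bob's input and Alice's output. Each of these pairs
carries two isotropic projections: onto the maximally entangled state and onto its complement.

Given a simulation `P`, the overlaps of its Choi matrix with the four products of isotropic
projections define a measurement `K, L, M, N` on the resource. The partial transpose turns certain
signed combinations of the isotropic projections into nonnegative multiples of the symmetric and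
antisymmetric projections, so that positivity of the partially transposed `P` gives the PPT
constraints. As `Tr[ρK]` is the overlap of the simulated channel with the swap channel in the
maximally entangled state, both errors are at least `1 - Tr[ρK]`.

Conversely, one can measure a feasible `K, L, M, N` on the resource and, depending on the outcome,
either transmit each of the two systems perfectly or replace its state by an isotropic error. The
constraints make this simulation PPT preserving. The simulated channel exceeds `Tr[ρK]` times the
swap channel by a completely positive map, so both errors are at most `1 - Tr[ρK]`.
-/

noncomputable section

open Matrix

namespace QChannel

section TraceNorm

variable {X : Type*} [Fintype X]

theorem trace_mul_nonneg {A B : Matrix X X ℂ} (hA : 0 ≤ A) (hB : 0 ≤ B) : 0 ≤ (A * B).trace := by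
  classical
  obtain ⟨C, rfl⟩ := CStarAlgebra.nonneg_iff_eq_star_mul_self.1 hA
  rw [Matrix.mul_assoc, trace_mul_comm]
  exact (hB.posSemidef.mul_mul_conjTranspose_same C).trace_nonneg

theorem trace_mul_le_trace_mul {A B C : Matrix X X ℂ} (hA : 0 ≤ A) (h : B ≤ C) :
    (A * B).trace ≤ (A * C).trace := by
  simpa only [Matrix.mul_sub, trace_sub, sub_nonneg] using trace_mul_nonneg hA (sub_nonneg.2 h)

theorem dotProduct_star_self_eq_norm_sq (v : X → ℂ) :
    star v ⬝ᵥ v = ((‖WithLp.toLp 2 v‖ ^ 2 : ℝ) : ℂ) := by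
  rw [dotProduct_comm, ← EuclideanSpace.inner_toLp_toLp, inner_self_eq_norm_sq_to_K]
  norm_cast

open scoped Classical in
theorem norm_abs_mulVec (A : Matrix X X ℂ) (v : X → ℂ) :
    ‖WithLp.toLp 2 (CFC.abs A *ᵥ v)‖ = ‖WithLp.toLp 2 (A *ᵥ v)‖ := by
  have hH : (CFC.abs A)ᴴ = CFC.abs A := (CFC.abs_nonneg A).posSemidef.isHermitian
  have h : (CFC.abs A)ᴴ * CFC.abs A = Aᴴ * A := by
    rw [hH, CFC.abs_mul_abs, star_eq_conjTranspose]
  rw [← sq_eq_sq₀ (norm_nonneg _) (norm_nonneg _), ← Complex.ofReal_inj,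
    ← dotProduct_star_self_eq_norm_sq, ← dotProduct_star_self_eq_norm_sq]
  simp only [star_mulVec, ← dotProduct_mulVec, mulVec_mulVec, h]

variable [DecidableEq X]

theorem re_trace_le_traceNorm (A : Matrix X X ℂ) : A.trace.re ≤ traceNorm A := by
  have hpos := (CFC.abs_nonneg A).posSemidef
  set b := hpos.isHermitian.eigenvectorBasis
  have htrace : A.trace = ∑ i, inner ℂ (b i) (WithLp.toLp 2 (A *ᵥ b i)) := by
    have := LinearMap.trace_eq_sum_inner (toLpLin 2 2 A) b
    rwa [toLpLin_eq_toLin, trace_toLin_eq] at this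
  rw [traceNorm, htrace, hpos.isHermitian.trace_eq_sum_eigenvalues, Complex.re_sum, Complex.re_sum]
  refine Finset.sum_le_sum fun i _ ↦ (re_inner_le_norm (𝕜 := ℂ) _ _).trans_eq ?_
  rw [← norm_abs_mulVec, hpos.isHermitian.mulVec_eigenvectorBasis]
  simp [norm_smul, abs_of_nonneg (hpos.eigenvalues_nonneg i), b]

theorem abs_eq_mul_cfc_sign {H : Matrix X X ℂ} (hH : H.IsHermitian) :
    CFC.abs H = H * cfc Real.sign H := by
  have hsa : IsSelfAdjoint H := hH
  have hc (f : ℝ → ℝ) : ContinuousOn f (spectrum ℝ H) := finite_real_spectrum.continuousOn f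
  have habs : (fun x : ℝ ↦ ‖x‖) = fun x ↦ x * Real.sign x := by
    ext x
    rcases lt_trichotomy x 0 with h | rfl | h
    · simp [Real.sign_of_neg h, abs_of_neg h]
    · simp
    · simp [Real.sign_of_pos h, abs_of_pos h]
  rw [CFC.abs_eq_cfc_norm H, habs, cfc_mul _ _ _ (hc _) (hc _), cfc_id' ℝ H]

theorem traceNorm_sub_le {A B : Matrix X X ℂ} (hA : 0 ≤ A) (hB : 0 ≤ B) :
    traceNorm (A - B) ≤ A.trace.re + B.trace.re := by
  have hH : (A - B).IsHermitian := hA.posSemidef.isHermitian.sub hB.posSemidef.isHermitian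
  set s := cfc Real.sign (A - B)
  have hs_le : s ≤ 1 := cfc_le_one _ _ fun x _ ↦ by
    rcases Real.sign_apply_eq x with h | h | h <;> norm_num [h]
  have le_hs : -1 ≤ s := by
    have := algebraMap_le_cfc Real.sign (-1) (A - B) (fun x _ ↦ by
      rcases Real.sign_apply_eq x with h | h | h <;> norm_num [h])
      (finite_real_spectrum.continuousOn _) hH
    simpa using this
  have hA_le := (Complex.le_def.1 (trace_mul_le_trace_mul hA hs_le)).1
  have le_hB := (Complex.le_def.1 (trace_mul_le_trace_mul hB le_hs)).1
  simp only [Matrix.mul_one, Matrix.mul_neg, trace_neg, Complex.neg_re] at hA_le le_hB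
  rw [traceNorm, abs_eq_mul_cfc_sign hH, Matrix.sub_mul, trace_sub, Complex.sub_re]
  linarith

theorem two_mul_re_trace_mul_le_traceNorm {H E : Matrix X X ℂ} (hH : H.IsHermitian)
    (htr : H.trace = 0) (hE : 0 ≤ E) (hE1 : E ≤ 1) : 2 * (H * E).trace.re ≤ traceNorm H := by
  have hsa : IsSelfAdjoint H := hH
  have habs : traceNorm H = 2 * (H⁺).trace.re := by
    simpa [htr, traceNorm, two_mul, two_smul] using
      congrArg (fun Y : Matrix X X ℂ ↦ Y.trace.re) (CFC.abs_add_self H)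
  have hpos := (Complex.le_def.1 (trace_mul_le_trace_mul (CFC.posPart_nonneg H) hE1)).1
  have hneg := (Complex.le_def.1 (trace_mul_nonneg (CFC.negPart_nonneg H) hE)).1
  rw [Matrix.mul_one] at hpos
  rw [habs]
  nth_rw 1 [← CFC.posPart_sub_negPart H]
  rw [Matrix.sub_mul, trace_sub, Complex.sub_re]
  rw [Complex.zero_re] at hneg
  linarith

end TraceNorm

section Fidelity

variable {X : Type*} [Fintype X]

open scoped Classical in
theorem sqrt_smul {k : ℝ} (hk : 0 ≤ k) {ω : Matrix X X ℂ} (hω : 0 ≤ ω) :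
    CFC.sqrt (k • ω) = √k • CFC.sqrt ω :=
  CFC.sqrt_unique
    (by rw [smul_mul_smul_comm, CFC.sqrt_mul_sqrt_self ω hω, Real.mul_self_sqrt hk])
    (smul_nonneg (Real.sqrt_nonneg k) (CFC.sqrt_nonneg ω))

open scoped Classical in
theorem sqrt_vecMulVec_self_star (φ : X → ℂ) :
    CFC.sqrt (vecMulVec φ (star φ)) = ‖WithLp.toLp 2 φ‖⁻¹ • vecMulVec φ (star φ) := by
  refine CFC.sqrt_unique ?_
    (smul_nonneg (by positivity) (posSemidef_vecMulVec_self_star φ).nonneg)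
  obtain rfl | hφ := eq_or_ne φ 0
  · simp
  have hnorm : ‖WithLp.toLp 2 φ‖ ≠ 0 := by simpa using hφ
  rw [smul_mul_smul_comm, vecMulVec_mul_vecMulVec, dotProduct_star_self_eq_norm_sq,
    Complex.coe_smul, vecMulVec_smul, smul_smul]
  field_simp
  simp

variable [DecidableEq X]

theorem traceNorm_vecMulVec (ψ φ : X → ℂ) :
    traceNorm (vecMulVec ψ (star φ)) = ‖WithLp.toLp 2 ψ‖ * ‖WithLp.toLp 2 φ‖ := by
  have habs : CFC.abs (vecMulVec ψ (star φ)) =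
      (‖WithLp.toLp 2 ψ‖ * ‖WithLp.toLp 2 φ‖⁻¹) • vecMulVec φ (star φ) := by
    rw [CFC.abs, star_eq_conjTranspose, conjTranspose_vecMulVec, star_star,
      vecMulVec_mul_vecMulVec, dotProduct_star_self_eq_norm_sq, Complex.coe_smul, vecMulVec_smul,
      sqrt_smul (sq_nonneg _) (posSemidef_vecMulVec_self_star φ).nonneg,
      Real.sqrt_sq (norm_nonneg _), sqrt_vecMulVec_self_star, smul_smul]
  rw [traceNorm, habs, trace_smul, trace_vecMulVec, dotProduct_comm,
    dotProduct_star_self_eq_norm_sq, Complex.smul_re, Complex.ofReal_re, smul_eq_mul]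
  field_simp

theorem fidelity_vecMulVec_self_star {ψ : X → ℂ} (hψ : star ψ ⬝ᵥ ψ = 1) {σ : Matrix X X ℂ}
    (hσ : 0 ≤ σ) : fidelity (vecMulVec ψ (star ψ)) σ = (σ * vecMulVec ψ (star ψ)).trace.re := by
  have hnorm : ‖WithLp.toLp 2 ψ‖ = 1 := by
    rw [dotProduct_star_self_eq_norm_sq] at hψ
    exact (pow_eq_one_iff_of_nonneg (norm_nonneg _) two_ne_zero).1 (mod_cast hψ)
  have hH : (CFC.sqrt σ)ᴴ = CFC.sqrt σ := (CFC.sqrt_nonneg σ).posSemidef.isHermitian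
  have hprod : vecMulVec ψ (star ψ) * CFC.sqrt σ = vecMulVec ψ (star (CFC.sqrt σ *ᵥ ψ)) := by
    rw [vecMulVec_mul, star_mulVec, hH]
  have hexp : (((‖WithLp.toLp 2 (CFC.sqrt σ *ᵥ ψ)‖ ^ 2 : ℝ)) : ℂ) =
      (σ * vecMulVec ψ (star ψ)).trace := by
    rw [← dotProduct_star_self_eq_norm_sq, star_mulVec, hH, ← dotProduct_mulVec, mulVec_mulVec,
      CFC.sqrt_mul_sqrt_self σ hσ, mul_vecMulVec, trace_vecMulVec, dotProduct_comm]
  rw [fidelity, sqrt_vecMulVec_self_star, hnorm, inv_one, one_smul, hprod, traceNorm_vecMulVec,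
    hnorm, one_mul, ← hexp, Complex.ofReal_re]

open scoped Matrix.Norms.L2Operator in
theorem le_fidelity {ω τ : Matrix X X ℂ} (hω : IsState ω) {k : ℝ} (hk : 0 ≤ k) (h : k • ω ≤ τ) :
    k ≤ fidelity ω τ := by
  have hω0 := hω.1.nonneg
  have hsqrt : √k • CFC.sqrt ω ≤ CFC.sqrt τ := by
    rw [← sqrt_smul hk hω0]
    exact CFC.sqrt_le_sqrt _ _ h
  have hle : √k ≤ (CFC.sqrt ω * CFC.sqrt τ).trace.re := by
    have := (Complex.le_def.1 (trace_mul_le_trace_mul (CFC.sqrt_nonneg ω) hsqrt)).1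
    rwa [Matrix.mul_smul, CFC.sqrt_mul_sqrt_self ω hω0, trace_smul, hω.2, Complex.smul_re,
      Complex.one_re, smul_eq_mul, mul_one] at this
  calc k = √k ^ 2 := (Real.sq_sqrt hk).symm
    _ ≤ fidelity ω τ := by
      unfold fidelity
      gcongr
      exact hle.trans (re_trace_le_traceNorm _)

end Fidelity

section CompletelyPositive

variable {C D E : Type*}

theorem IsCP.posSemidef_ampliate {R : Type*} [Finite R] {Φ : Matrix C C ℂ →ₗ[ℂ] Matrix D D ℂ}
    (hΦ : IsCP Φ) {X : Matrix (R × C) (R × C) ℂ} (hX : X.PosSemidef) :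
    (ampliate R Φ X).PosSemidef := by
  let e := Finite.equivFin R
  have h := (hΦ _ _ (hX.submatrix (Prod.map e.symm id))).submatrix (Prod.map e id)
  convert h using 1
  ext
  simp [ampliate]

theorem IsCP.sum {κ : Type*} (s : Finset κ) {Φ : κ → Matrix C C ℂ →ₗ[ℂ] Matrix D D ℂ}
    (h : ∀ k ∈ s, IsCP (Φ k)) : IsCP (∑ k ∈ s, Φ k) := by
  intro n X hX
  have hsum : ampliate (Fin n) (∑ k ∈ s, Φ k) X = ∑ k ∈ s, ampliate (Fin n) (Φ k) X := by
    ext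
    simp [ampliate, Matrix.sum_apply]
  rw [hsum]
  exact posSemidef_sum s fun k hk ↦ h k hk n X hX

theorem IsCP.comp {Φ : Matrix C C ℂ →ₗ[ℂ] Matrix D D ℂ} {Ψ : Matrix D D ℂ →ₗ[ℂ] Matrix E E ℂ}
    (hΨ : IsCP Ψ) (hΦ : IsCP Φ) : IsCP (Ψ ∘ₗ Φ) :=
  fun n X hX ↦ hΨ n _ (hΦ n X hX)

theorem IsChannel.comp [Fintype C] [Fintype D] [Fintype E] {Φ : Matrix C C ℂ →ₗ[ℂ] Matrix D D ℂ}
    {Ψ : Matrix D D ℂ →ₗ[ℂ] Matrix E E ℂ} (hΨ : IsChannel Ψ) (hΦ : IsChannel Φ) :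
    IsChannel (Ψ ∘ₗ Φ) :=
  ⟨hΨ.1.comp hΦ.1, fun X ↦ (hΨ.2 (Φ X)).trans (hΦ.2 X)⟩

theorem IsChannel.isState_ampliate [Fintype C] [Fintype D] {Φ : Matrix C C ℂ →ₗ[ℂ] Matrix D D ℂ}
    (hΦ : IsChannel Φ) {n : ℕ} {ρ : Matrix (Fin n × C) (Fin n × C) ℂ} (hρ : IsState ρ) :
    IsState (ampliate (Fin n) Φ ρ) := by
  refine ⟨hΦ.1 n ρ hρ.1, ?_⟩
  rw [← hρ.2]
  simp only [trace, Fintype.sum_prod_type]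
  exact Finset.sum_congr rfl fun r _ ↦ hΦ.2 (Matrix.of fun c c' ↦ ρ (r, c) (r, c'))

end CompletelyPositive

section Choi

variable {C D : Type*}

theorem posSemidef_sum_blocks {Y Z : Type*} [Finite Y] [Fintype Z] {H : Matrix (Y × Z) (Y × Z) ℂ}
    (hH : H.PosSemidef) : (Matrix.of fun y y' ↦ ∑ z, ∑ z', H (y, z) (y', z')).PosSemidef := by
  classical
  have := Fintype.ofFinite Y
  let V : Matrix Y (Y × Z) ℂ := Matrix.of fun y p ↦ if p.1 = y then 1 else 0
  convert hH.mul_mul_conjTranspose_same V using 1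
  ext y y'
  simp only [V, Matrix.mul_apply, Fintype.sum_prod_type_right, of_apply, conjTranspose_apply,
    apply_ite star, star_one, star_zero, ite_mul, one_mul, zero_mul, mul_ite, mul_one, mul_zero,
    Finset.sum_ite_eq', Finset.mem_univ, if_true]
  exact Finset.sum_comm

/-- The vector `∑ i, |i⟩ ⊗ |i⟩` on two copies of a system. -/
def maxEntVec (C : Type*) [DecidableEq C] : C × C → ℂ :=
  fun p ↦ (1 : Matrix C C ℂ) p.1 p.2

/-- The unnormalized maximally entangled operator `∑ i j, |i⟩⟨j| ⊗ |i⟩⟨j|`. -/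
def maxEnt (C : Type*) [DecidableEq C] : Matrix (C × C) (C × C) ℂ :=
  vecMulVec (maxEntVec C) (star (maxEntVec C))

theorem maxEnt_apply [DecidableEq C] (p q : C × C) :
    maxEnt C p q = if p.1 = p.2 ∧ q.1 = q.2 then 1 else 0 := by
  simp only [maxEnt, maxEntVec, vecMulVec_apply, Pi.star_apply, one_apply, apply_ite star, star_one,
    star_zero, ite_and, ite_mul, one_mul, zero_mul]

/-- The Choi matrix `∑ i j, |i⟩⟨j| ⊗ Φ(|i⟩⟨j|)` of a linear map `Φ` on operators, as a linear
equivalence. -/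
def choi [Fintype C] [DecidableEq C] :
    (Matrix C C ℂ →ₗ[ℂ] Matrix D D ℂ) ≃ₗ[ℂ] Matrix (C × D) (C × D) ℂ where
  toFun Φ := Matrix.of fun p q ↦ Φ (single p.1 q.1 1) p.2 q.2
  map_add' _ _ := rfl
  map_smul' _ _ := rfl
  invFun J :=
    { toFun X := Matrix.of fun d d' ↦ ∑ c, ∑ c', X c c' * J (c, d) (c', d')
      map_add' _ _ := by ext; simp [add_mul, Finset.sum_add_distrib]
      map_smul' _ _ := by ext; simp [Finset.mul_sum, mul_assoc] }
  left_inv Φ := by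
    refine ext_linearMap _ fun c c' ↦ LinearMap.ext_ring ?_
    ext d d'
    simp [single_apply, ite_and]
  right_inv J := by
    ext
    simp [single_apply, ite_and]

variable [Fintype C] [DecidableEq C]

theorem choi_apply (Φ : Matrix C C ℂ →ₗ[ℂ] Matrix D D ℂ) (p q : C × D) :
    choi Φ p q = Φ (single p.1 q.1 1) p.2 q.2 := rfl

theorem choi_symm_apply (J : Matrix (C × D) (C × D) ℂ) (X : Matrix C C ℂ) (d d' : D) :
    choi.symm J X d d' = ∑ c, ∑ c', X c c' * J (c, d) (c', d') := rfl

theorem ampliate_maxEnt (Φ : Matrix C C ℂ →ₗ[ℂ] Matrix D D ℂ) :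
    ampliate C Φ (maxEnt C) = choi Φ := by
  ext ⟨c, d⟩ ⟨c', d'⟩
  have : (Matrix.of fun a a' ↦ maxEnt C (c, a) (c', a')) = single c c' 1 := by
    ext
    simp only [maxEnt_apply, single_apply, of_apply]
  simp only [ampliate, choi_apply, of_apply, this]

theorem isCP_iff_posSemidef_choi [Finite D] (Φ : Matrix C C ℂ →ₗ[ℂ] Matrix D D ℂ) :
    IsCP Φ ↔ (choi Φ).PosSemidef := by
  refine ⟨fun h ↦ ?_, fun h n X hX ↦ ?_⟩
  · rw [← ampliate_maxEnt]
    exact h.posSemidef_ampliate (posSemidef_vecMulVec_self_star _)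
  · -- Schur's product theorem: `Φ X` sums the blocks of the Hadamard product of `X` and `choi Φ`.
    convert posSemidef_sum_blocks (Y := Fin n × D) (Z := C)
      ((hX.submatrix fun p ↦ (p.1.1, p.2)).hadamard (h.submatrix fun p ↦ (p.2, p.1.2))) using 1
    ext p q
    conv_lhs => rw [← choi.symm_apply_apply Φ]
    simp only [ampliate, choi_symm_apply, of_apply, hadamard_apply, submatrix_apply]

theorem trace_preserving_iff_sum_choi [Fintype D] (Φ : Matrix C C ℂ →ₗ[ℂ] Matrix D D ℂ) :
    (∀ X, (Φ X).trace = X.trace) ↔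
      ∀ c c', ∑ d, choi Φ (c, d) (c', d) = (1 : Matrix C C ℂ) c c' := by
  have htrace (c c' : C) : (single c c' (1 : ℂ)).trace = (1 : Matrix C C ℂ) c c' := by
    obtain rfl | hne := eq_or_ne c c'
    · simp
    · simp [trace_single_eq_of_ne, hne]
  refine ⟨fun h c c' ↦ (h _).trans (htrace c c'), fun h X ↦ ?_⟩
  have hext : traceLinearMap D ℂ ℂ ∘ₗ Φ = traceLinearMap C ℂ ℂ :=
    ext_linearMap _ fun c c' ↦ LinearMap.ext_ring ((h c c').trans (htrace c c').symm)
  exact LinearMap.congr_fun hext X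

end Choi

section Contract

variable {A B R : Type*} [Fintype R]

/-- The partial contraction `Tr_R[X (1 ⊗ K)]`, as a bilinear map in `K` and `X`. The function `f`
tells how the labels of the remaining system and of `R` combine to a label of the system on which
`X` acts. -/
def contract (f : A → R → B) : Matrix R R ℂ →ₗ[ℂ] Matrix B B ℂ →ₗ[ℂ] Matrix A A ℂ :=
  LinearMap.mk₂ ℂ
    (fun K X ↦ Matrix.of fun a a' ↦ ∑ r, ∑ r', X (f a r) (f a' r') * K r' r)
    (fun _ _ _ ↦ by ext; simp [mul_add, Finset.sum_add_distrib])
    (fun _ _ _ ↦ by ext; simp [Finset.mul_sum, mul_left_comm])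
    (fun _ _ _ ↦ by ext; simp [add_mul, Finset.sum_add_distrib])
    (fun _ _ _ ↦ by ext; simp [Finset.mul_sum, mul_assoc])

theorem contract_apply (f : A → R → B) (K : Matrix R R ℂ) (X : Matrix B B ℂ) (a a' : A) :
    contract f K X a a' = ∑ r, ∑ r', X (f a r) (f a' r') * K r' r := rfl

theorem posSemidef_contract [Finite A] (f : A → R → B) {K : Matrix R R ℂ} (hK : K.PosSemidef)
    {X : Matrix B B ℂ} (hX : X.PosSemidef) : (contract f K X).PosSemidef := by
  convert posSemidef_sum_blocks (Y := A) (Z := R)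
    ((hX.submatrix fun p ↦ f p.1 p.2).hadamard (hK.transpose.submatrix Prod.snd)) using 1
  ext a a'
  simp only [contract_apply, of_apply, hadamard_apply, submatrix_apply, transpose_apply]

theorem isCP_contract [Finite A] (f : A → R → B) {K : Matrix R R ℂ} (hK : K.PosSemidef) :
    IsCP (contract f K) :=
  fun n _ hX ↦ posSemidef_contract (fun (p : Fin n × A) r ↦ (p.1, f p.2 r)) hK hX

theorem trace_contract_mul [Fintype A] (f : A → R → B) (K : Matrix R R ℂ) (X : Matrix B B ℂ)
    (L : Matrix A A ℂ) :
    (contract f K X * L).trace = (contract (flip f) L X * K).trace := by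
  simp only [trace, diag_apply, Matrix.mul_apply, contract_apply, flip, Finset.sum_mul]
  rw [Finset.sum_congr rfl fun a _ ↦ Finset.sum_comm, Finset.sum_comm]
  refine Finset.sum_congr rfl fun r _ ↦ ?_
  rw [Finset.sum_congr rfl fun a _ ↦ Finset.sum_comm, Finset.sum_comm]
  simp only [mul_right_comm]

theorem trace_contract_one [Fintype A] [Fintype B] [DecidableEq R] {f : A → R → B}
    (hf : Function.Bijective (Function.uncurry f)) (X : Matrix B B ℂ) :
    (contract f 1 X).trace = X.trace := by
  simp only [trace, diag_apply, contract_apply, one_apply, mul_ite, mul_one, mul_zero,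
    Finset.sum_ite_eq', Finset.mem_univ, if_true]
  rw [← Fintype.sum_prod_type']
  exact hf.sum_comp fun b ↦ X b b

end Contract

section MaxEntInput

variable {C D : Type*} [Fintype C] [DecidableEq C] [Nonempty C]

variable (C D) in
theorem exists_ampliate_eq_smul_choi :
    ∃ (n : ℕ) (e : Fin n ≃ C) (ρ : Matrix (Fin n × C) (Fin n × C) ℂ), IsState ρ ∧
      ∀ Φ : Matrix C C ℂ →ₗ[ℂ] Matrix D D ℂ, ampliate (Fin n) Φ ρ =
        (Fintype.card C : ℝ)⁻¹ •
          (choi Φ).submatrix (e.prodCongr (.refl D)) (e.prodCongr (.refl D)) := by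
  let e := (Fintype.equivFin C).symm
  refine ⟨_, e, (Fintype.card C : ℝ)⁻¹ •
    (maxEnt C).submatrix (e.prodCongr (.refl C)) (e.prodCongr (.refl C)), ⟨?_, ?_⟩, fun Φ ↦ ?_⟩
  · exact ((posSemidef_vecMulVec_self_star _).submatrix _).smul (by positivity)
  · have hsum : ∑ p, maxEnt C p p = Fintype.card C := by
      rw [Fintype.sum_prod_type]
      simp [maxEnt_apply]
    have htr : ((maxEnt C).submatrix (e.prodCongr (.refl C)) (e.prodCongr (.refl C))).trace =
        Fintype.card C := ((e.prodCongr (.refl C)).sum_comp fun p ↦ maxEnt C p p).trans hsum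
    rw [trace_smul, htr, Complex.real_smul]
    simp
  · rw [← ampliate_maxEnt]
    ext p q
    have (a a' : C) : Matrix.of (fun c c' ↦ (Fintype.card C : ℝ)⁻¹ • maxEnt C (a, c) (a', c')) =
        (Fintype.card C : ℝ)⁻¹ • Matrix.of (fun c c' ↦ maxEnt C (a, c) (a', c')) := rfl
    exact congr_fun₂ ((congrArg Φ (this (e p.1) (e q.1))).trans (Φ.map_smul_of_tower _ _)) p.2 q.2

theorem exists_ampliate_eq_vecMulVec [Fintype D] {N : Matrix C C ℂ →ₗ[ℂ] Matrix D D ℂ}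
    {u : C × D → ℂ} (hu : choi N = vecMulVec u (star u)) :
    ∃ (n : ℕ) (ρ : Matrix (Fin n × C) (Fin n × C) ℂ) (ψ : Fin n × D → ℂ), IsState ρ ∧
      ampliate (Fin n) N ρ = vecMulVec ψ (star ψ) ∧
      ∀ M : Matrix C C ℂ →ₗ[ℂ] Matrix D D ℂ,
        (ampliate (Fin n) M ρ * ampliate (Fin n) N ρ).trace.re =
          (choi M * choi N).trace.re / Fintype.card C ^ 2 := by
  obtain ⟨n, e, ρ, hρ, hampliate⟩ := exists_ampliate_eq_smul_choi C D
  refine ⟨n, ρ, √(Fintype.card C : ℝ)⁻¹ • u ∘ e.prodCongr (.refl D), hρ, ?_, fun M ↦ ?_⟩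
  · rw [hampliate, hu, star_smul, star_trivial (√_), vecMulVec_smul, smul_vecMulVec, smul_smul,
      Real.mul_self_sqrt (inv_nonneg.2 (Nat.cast_nonneg _))]
    rfl
  · have htr : ((choi M * choi N).submatrix (e.prodCongr (.refl D)) (e.prodCongr (.refl D))).trace =
        (choi M * choi N).trace :=
      (e.prodCongr (.refl D)).sum_comp fun p ↦ (choi M * choi N) p p
    rw [hampliate, hampliate, Matrix.smul_mul, Matrix.mul_smul, submatrix_mul_equiv, smul_smul,
      trace_smul, htr, Complex.smul_re, smul_eq_mul]
    field_simp

end MaxEntInput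

section Distance

variable {C D : Type*} [Fintype C] [Fintype D] [DecidableEq D]
  {N M : Matrix C C ℂ →ₗ[ℂ] Matrix D D ℂ}

theorem IsChannel.traceNorm_ampliate_sub_le (hN : IsChannel N) (hM : IsChannel M) {k : ℝ}
    (hk : k ≤ 1) (h : IsCP (M - k • N)) {n : ℕ} {ρ : Matrix (Fin n × C) (Fin n × C) ℂ}
    (hρ : IsState ρ) :
    traceNorm (ampliate (Fin n) N ρ - ampliate (Fin n) M ρ) ≤ 2 * (1 - k) := by
  obtain ⟨hNρ, htrN⟩ := hN.isState_ampliate hρ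
  obtain ⟨-, htrM⟩ := hM.isState_ampliate hρ
  have hT : 0 ≤ ampliate (Fin n) M ρ - k • ampliate (Fin n) N ρ := (h n ρ hρ.1).nonneg
  have hsplit : ampliate (Fin n) N ρ - ampliate (Fin n) M ρ =
      (1 - k) • ampliate (Fin n) N ρ - (ampliate (Fin n) M ρ - k • ampliate (Fin n) N ρ) := by
    module
  rw [hsplit]
  refine (traceNorm_sub_le (hNρ.smul (sub_nonneg.2 hk)).nonneg hT).trans_eq ?_
  simp only [trace_sub, trace_smul, htrN, htrM, Complex.sub_re, Complex.smul_re, Complex.one_re,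
    smul_eq_mul]
  ring

theorem diamondDist_le (hN : IsChannel N) (hM : IsChannel M) {k : ℝ} (hk : k ≤ 1)
    (h : IsCP (M - k • N)) : diamondDist N M ≤ 2 * (1 - k) := by
  refine Real.sSup_le ?_ (by linarith)
  rintro t ⟨n, ρ, hρ, rfl⟩
  exact hN.traceNorm_ampliate_sub_le hM hk h hρ

theorem bddAbove_traceNorm_ampliate_sub (hN : IsChannel N) (hM : IsChannel M) :
    BddAbove {t : ℝ | ∃ (n : ℕ) (ρ : Matrix (Fin n × C) (Fin n × C) ℂ), IsState ρ ∧
      t = traceNorm (ampliate (Fin n) N ρ - ampliate (Fin n) M ρ)} := by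
  refine ⟨2 * (1 - 0), ?_⟩
  rintro t ⟨n, ρ, hρ, rfl⟩
  exact hN.traceNorm_ampliate_sub_le hM zero_le_one (by simpa using hM.1) hρ

theorem one_sub_le_half_diamondDist (hN : IsChannel N) (hM : IsChannel M) {n : ℕ}
    {ρ : Matrix (Fin n × C) (Fin n × C) ℂ} (hρ : IsState ρ) {ψ : Fin n × D → ℂ}
    (hψ : ampliate (Fin n) N ρ = vecMulVec ψ (star ψ)) :
    1 - (ampliate (Fin n) M ρ * ampliate (Fin n) N ρ).trace.re ≤ 1 / 2 * diamondDist N M := by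
  obtain ⟨hNρ, htrN⟩ := hN.isState_ampliate hρ
  obtain ⟨hMρ, htrM⟩ := hM.isState_ampliate hρ
  have hidem : ampliate (Fin n) N ρ * ampliate (Fin n) N ρ = ampliate (Fin n) N ρ := by
    rw [hψ, trace_vecMulVec, dotProduct_comm] at htrN
    rw [hψ, vecMulVec_mul_vecMulVec, htrN, one_smul]
  have hproj : IsStarProjection (ampliate (Fin n) N ρ) := ⟨hidem, hNρ.isHermitian⟩
  have htest := two_mul_re_trace_mul_le_traceNorm (hNρ.isHermitian.sub hMρ.isHermitian)
    (by rw [trace_sub, htrN, htrM, sub_self]) hproj.nonneg hproj.le_one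
  have hsup := le_csSup (bddAbove_traceNorm_ampliate_sub hN hM) ⟨n, ρ, hρ, rfl⟩
  change _ ≤ diamondDist N M at hsup
  rw [Matrix.sub_mul, trace_sub, hidem, htrN, Complex.sub_re, Complex.one_re] at htest
  linarith

theorem channelFidelity_le (hN : IsChannel N) (hM : IsChannel M) {n : ℕ}
    {ρ : Matrix (Fin n × C) (Fin n × C) ℂ} (hρ : IsState ρ) {ψ : Fin n × D → ℂ}
    (hψ : ampliate (Fin n) N ρ = vecMulVec ψ (star ψ)) :
    channelFidelity N M ≤ (ampliate (Fin n) M ρ * ampliate (Fin n) N ρ).trace.re := by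
  have htr := (hN.isState_ampliate hρ).2
  rw [hψ, trace_vecMulVec, dotProduct_comm] at htr
  rw [hψ, ← fidelity_vecMulVec_self_star htr (hM.isState_ampliate hρ).1.nonneg, ← hψ]
  refine csInf_le ⟨0, ?_⟩ ⟨n, ρ, hρ, rfl⟩
  rintro t ⟨n, ρ, -, rfl⟩
  exact sq_nonneg _

open scoped Classical in
theorem le_channelFidelity [Nonempty C] (hN : IsChannel N) {k : ℝ} (hk : 0 ≤ k)
    (h : IsCP (M - k • N)) : k ≤ channelFidelity N M := by
  obtain ⟨n, -, ρ, hρ, -⟩ := exists_ampliate_eq_smul_choi C C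
  refine le_csInf ⟨_, n, ρ, hρ, rfl⟩ ?_
  rintro t ⟨n, ρ, hρ, rfl⟩
  exact le_fidelity (hN.isState_ampliate hρ) hk (h n ρ hρ.1)

variable [Nonempty C] [DecidableEq C]

theorem one_sub_trace_choi_mul_le_half_diamondDist (hN : IsChannel N) (hM : IsChannel M)
    {u : C × D → ℂ} (hu : choi N = vecMulVec u (star u)) :
    1 - (choi M * choi N).trace.re / Fintype.card C ^ 2 ≤ 1 / 2 * diamondDist N M := by
  obtain ⟨n, ρ, ψ, hρ, hψ, htr⟩ := exists_ampliate_eq_vecMulVec hu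
  exact htr M ▸ one_sub_le_half_diamondDist hN hM hρ hψ

theorem channelFidelity_le_trace_choi_mul (hN : IsChannel N) (hM : IsChannel M)
    {u : C × D → ℂ} (hu : choi N = vecMulVec u (star u)) :
    channelFidelity N M ≤ (choi M * choi N).trace.re / Fintype.card C ^ 2 := by
  obtain ⟨n, ρ, ψ, hρ, hψ, htr⟩ := exists_ampliate_eq_vecMulVec hu
  exact htr M ▸ channelFidelity_le hN hM hρ hψ

end Distance

section PartialTranspose

variable {ι : Type*} [DecidableEq ι] {A A' B R : ι → Type*}

theorem partialTranspose_apply (S : Finset ι) (X : Matrix (∀ i, A i) (∀ i, A i) ℂ)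
    (x y : ∀ i, A i) :
    partialTranspose S X x y = X (S.piecewise y x) (S.piecewise x y) := rfl

theorem partialTranspose_empty : partialTranspose (A := A) ∅ = LinearMap.id := by
  ext
  simp [partialTranspose_apply]

theorem piecewise_piecewise_swap (S : Finset ι) (x y : ∀ i, A i) :
    S.piecewise (S.piecewise x y) (S.piecewise y x) = x := by
  simp [Finset.piecewise_same]

theorem partialTranspose_partialTranspose (S : Finset ι) (X : Matrix (∀ i, A i) (∀ i, A i) ℂ) :
    partialTranspose S (partialTranspose S X) = X := by
  ext
  simp only [partialTranspose_apply, piecewise_piecewise_swap]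

theorem partialTranspose_compl [Fintype ι] (S : Finset ι) (X : Matrix (∀ i, A i) (∀ i, A i) ℂ) :
    partialTranspose Sᶜ X = (partialTranspose S X)ᵀ := by
  ext
  simp only [partialTranspose_apply, Finset.piecewise_compl, transpose_apply]

theorem partialTranspose_one [∀ i, DecidableEq (A i)] [Fintype ι] (S : Finset ι) :
    partialTranspose S (1 : Matrix (∀ i, A i) (∀ i, A i) ℂ) = 1 := by
  ext x y
  have hxy : S.piecewise y x = S.piecewise x y ↔ x = y := by
    simp only [funext_iff, Finset.piecewise]
    exact forall_congr' fun i ↦ by split_ifs <;> simp only [eq_comm]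
  simp only [partialTranspose_apply, one_apply, hxy]

theorem partialTranspose_single [∀ i, DecidableEq (A i)] [Fintype ι] (S : Finset ι)
    (x y : ∀ i, A i) (c : ℂ) :
    partialTranspose S (single x y c) = single (S.piecewise y x) (S.piecewise x y) c := by
  ext u v
  have hiff : x = S.piecewise v u ∧ y = S.piecewise u v ↔
      S.piecewise y x = u ∧ S.piecewise x y = v := by
    constructor <;> rintro ⟨rfl, rfl⟩ <;> simp [Finset.piecewise_same]
  simp only [partialTranspose_apply, single_apply, hiff]

theorem sum_sum_piecewise [Fintype ι] [∀ i, Fintype (A i)] (S : Finset ι)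
    (f : (∀ i, A i) → (∀ i, A i) → ℂ) :
    ∑ x, ∑ y, f (S.piecewise y x) (S.piecewise x y) = ∑ x, ∑ y, f x y := by
  have hinv : Function.Involutive fun p : (∀ i, A i) × (∀ i, A i) ↦
      (S.piecewise p.2 p.1, S.piecewise p.1 p.2) := fun p ↦ by simp [Finset.piecewise_same]
  rw [← Fintype.sum_prod_type', ← Fintype.sum_prod_type']
  exact hinv.bijective.sum_comp fun p ↦ f p.1 p.2

theorem partialTranspose_contract [Fintype ι] [∀ i, Fintype (R i)] (g : ∀ i, A i → R i → B i)
    (S : Finset ι) (K : Matrix (∀ i, R i) (∀ i, R i) ℂ) (X : Matrix (∀ i, B i) (∀ i, B i) ℂ) :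
    partialTranspose S (contract (fun a r i ↦ g i (a i) (r i)) K X) =
      contract (fun a r i ↦ g i (a i) (r i)) (partialTranspose S K) (partialTranspose S X) := by
  ext a a'
  have hg (u v : ∀ i, A i) (r r' : ∀ i, R i) :
      (S.piecewise (fun i ↦ g i (u i) (r i)) fun i ↦ g i (v i) (r' i)) =
        fun i ↦ g i (S.piecewise u v i) (S.piecewise r r' i) := by
    simpa only [Finset.piecewise_coe] using Set.piecewise_op₂ (s := (S : Set ι)) u v r r' g
  simp only [partialTranspose_apply, contract_apply, hg]
  exact (sum_sum_piecewise S fun r r' ↦ X (fun i ↦ g i (S.piecewise a' a i) (r i))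
    (fun i ↦ g i (S.piecewise a a' i) (r' i)) * K r' r).symm

end PartialTranspose

section PartyChoi

variable {ι : Type*} [Fintype ι] [DecidableEq ι] {A A' : ι → Type*} [∀ i, Fintype (A i)]
  [∀ i, DecidableEq (A i)]

/-- The Choi matrix of a multipartite map, as an operator on the system that each party obtains by
joining its input and output systems. -/
def partyChoi : (Matrix (∀ i, A i) (∀ i, A i) ℂ →ₗ[ℂ] Matrix (∀ i, A' i) (∀ i, A' i) ℂ) ≃ₗ[ℂ]
    Matrix (∀ i, A i × A' i) (∀ i, A i × A' i) ℂ :=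
  choi ≪≫ₗ reindexLinearEquiv ℂ ℂ (Equiv.arrowProdEquivProdArrow ι A A').symm
    (Equiv.arrowProdEquivProdArrow ι A A').symm

theorem partyChoi_apply
    (Φ : Matrix (∀ i, A i) (∀ i, A i) ℂ →ₗ[ℂ] Matrix (∀ i, A' i) (∀ i, A' i) ℂ)
    (x y : ∀ i, A i × A' i) : partyChoi Φ x y =
      Φ (single (fun i ↦ (x i).1) (fun i ↦ (y i).1) 1) (fun i ↦ (x i).2) (fun i ↦ (y i).2) := rfl

theorem trace_partyChoi_mul [∀ i, Fintype (A' i)]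
    (Φ Ψ : Matrix (∀ i, A i) (∀ i, A i) ℂ →ₗ[ℂ] Matrix (∀ i, A' i) (∀ i, A' i) ℂ) :
    (partyChoi Φ * partyChoi Ψ).trace = (choi Φ * choi Ψ).trace := by
  let e := Equiv.arrowProdEquivProdArrow ι A A'
  have hmul : partyChoi Φ * partyChoi Ψ = (choi Φ * choi Ψ).submatrix e e :=
    submatrix_mul_equiv _ _ _ e _
  rw [hmul]
  exact e.sum_comp fun p ↦ (choi Φ * choi Ψ) p p

theorem isCP_iff_posSemidef_partyChoi [∀ i, Finite (A' i)]
    (Φ : Matrix (∀ i, A i) (∀ i, A i) ℂ →ₗ[ℂ] Matrix (∀ i, A' i) (∀ i, A' i) ℂ) :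
    IsCP Φ ↔ (partyChoi Φ).PosSemidef :=
  (isCP_iff_posSemidef_choi Φ).trans
    (posSemidef_submatrix_equiv (Equiv.arrowProdEquivProdArrow ι A A')).symm

theorem partyChoi_partialTranspose_comp (S : Finset ι)
    (Φ : Matrix (∀ i, A i) (∀ i, A i) ℂ →ₗ[ℂ] Matrix (∀ i, A' i) (∀ i, A' i) ℂ) :
    partyChoi (partialTranspose S ∘ₗ Φ ∘ₗ partialTranspose S) =
      partialTranspose S (partyChoi Φ) := by
  ext x y
  have hfst (u v : ∀ i, A i × A' i) : (fun i ↦ (S.piecewise u v i).1) =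
      S.piecewise (fun i ↦ (u i).1) fun i ↦ (v i).1 := by
    simpa only [Finset.piecewise_coe] using
      (Set.piecewise_op (s := (S : Set ι)) u v fun _ ↦ Prod.fst).symm
  have hsnd (u v : ∀ i, A i × A' i) : (fun i ↦ (S.piecewise u v i).2) =
      S.piecewise (fun i ↦ (u i).2) fun i ↦ (v i).2 := by
    simpa only [Finset.piecewise_coe] using
      (Set.piecewise_op (s := (S : Set ι)) u v fun _ ↦ Prod.snd).symm
  simp only [partyChoi_apply, partialTranspose_apply, LinearMap.comp_apply,
    partialTranspose_single, hfst, hsnd]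

end PartyChoi

section CompletelyPPTPreserving

variable {ι : Type*} [Fintype ι] [DecidableEq ι] {A A' : ι → Type*} [∀ i, Finite (A i)]
  [∀ i, Finite (A' i)]

theorem isCP_partialTranspose_compl_comp {S : Finset ι}
    {Φ : Matrix (∀ i, A i) (∀ i, A i) ℂ →ₗ[ℂ] Matrix (∀ i, A' i) (∀ i, A' i) ℂ}
    (h : IsCP (partialTranspose S ∘ₗ Φ ∘ₗ partialTranspose S)) :
    IsCP (partialTranspose Sᶜ ∘ₗ Φ ∘ₗ partialTranspose Sᶜ) := by
  classical
  have (i : ι) := Fintype.ofFinite (A i)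
  rw [isCP_iff_posSemidef_partyChoi, partyChoi_partialTranspose_comp] at h ⊢
  rw [partialTranspose_compl]
  exact h.transpose

end CompletelyPPTPreserving

theorem isCPPTP_of_forall_singleton {A A' : Party → Type*} [∀ p, Fintype (A p)]
    [∀ p, Fintype (A' p)]
    {P : Matrix (∀ p, A p) (∀ p, A p) ℂ →ₗ[ℂ] Matrix (∀ p, A' p) (∀ p, A' p) ℂ}
    (hP : IsChannel P) (h : ∀ p, IsCP (partialTranspose {p} ∘ₗ P ∘ₗ partialTranspose {p})) :
    IsCPPTP P := by
  refine ⟨hP, fun S ↦ ?_⟩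
  have hempty : IsCP (partialTranspose ∅ ∘ₗ P ∘ₗ partialTranspose ∅) := by
    simpa only [partialTranspose_empty, LinearMap.id_comp, LinearMap.comp_id] using hP.1
  have hS : S = ∅ ∨ S = ∅ᶜ ∨ ∃ p, S = {p} ∨ S = {p}ᶜ := by
    revert S
    decide
  rcases hS with rfl | rfl | ⟨p, rfl | rfl⟩
  exacts [hempty, isCP_partialTranspose_compl_comp hempty, h p,
    isCP_partialTranspose_compl_comp (h p)]

section Resource

variable {ι : Type*} {A R : ι → Type*}

theorem tensorResource_apply (ρ : Matrix (∀ i, R i) (∀ i, R i) ℂ)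
    (ω : Matrix (∀ i, A i) (∀ i, A i) ℂ) (x y : ∀ i, A i × R i) : tensorResource ρ ω x y =
      ω (fun i ↦ (x i).1) (fun i ↦ (y i).1) * ρ (fun i ↦ (x i).2) (fun i ↦ (y i).2) := rfl

theorem tensorResource_single [Fintype ι] [DecidableEq ι] [∀ i, Fintype (R i)]
    [∀ i, DecidableEq (A i)] [∀ i, DecidableEq (R i)]
    (ρ : Matrix (∀ i, R i) (∀ i, R i) ℂ) (a a' : ∀ i, A i) :
    tensorResource ρ (single a a' 1) = ∑ r, ∑ r', ρ r r' •
      single (fun i ↦ (a i, r i) : ∀ i, A i × R i) (fun i ↦ (a' i, r' i)) 1 := by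
  ext x y
  have hiff (b : ∀ i, A i) (r : ∀ i, R i) (z : ∀ i, A i × R i) : (fun i ↦ (b i, r i)) = z ↔
      (b = fun i ↦ (z i).1) ∧ r = fun i ↦ (z i).2 := by
    simp only [funext_iff, Prod.ext_iff, forall_and]
  simp only [tensorResource_apply, Matrix.sum_apply, Matrix.smul_apply, single_apply, hiff,
    smul_eq_mul]
  by_cases hx : a = fun i ↦ (x i).1 <;> by_cases hy : a' = fun i ↦ (y i).1 <;>
    simp [hx, hy, ite_and]

theorem isChannel_tensorResource [Fintype ι] [DecidableEq ι] [∀ i, Fintype (A i)]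
    [∀ i, Fintype (R i)] {ρ : Matrix (∀ i, R i) (∀ i, R i) ℂ} (hρ : IsState ρ) :
    IsChannel (tensorResource (A := A) ρ) := by
  refine ⟨fun n X hX ↦ ?_, fun X ↦ ?_⟩
  · exact (hX.submatrix fun p : Fin n × (∀ i, A i × R i) ↦ (p.1, fun i ↦ (p.2 i).1)).hadamard
      (hρ.1.submatrix fun p : Fin n × (∀ i, A i × R i) ↦ fun i ↦ (p.2 i).2)
  · calc (tensorResource ρ X).trace = ∑ p : (∀ i, A i) × (∀ i, R i), X p.1 p.1 * ρ p.2 p.2 :=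
          (Equiv.arrowProdEquivProdArrow ι A R).sum_comp fun p ↦ X p.1 p.1 * ρ p.2 p.2
      _ = X.trace * ρ.trace := by
          rw [Fintype.sum_prod_type, trace, trace, Finset.sum_mul_sum]
          rfl
      _ = X.trace := by rw [hρ.2, mul_one]

variable [Fintype ι] [DecidableEq ι] [∀ i, Fintype (R i)]

/-- The map `X ↦ Tr_R[X (1 ⊗ K)]`, which discards the resource systems `R` after a measurement
on them has yielded the outcome with effect `K`. -/
def measureResource : Matrix (∀ i, R i) (∀ i, R i) ℂ →ₗ[ℂ]
    Matrix (∀ i, A i × R i) (∀ i, A i × R i) ℂ →ₗ[ℂ] Matrix (∀ i, A i) (∀ i, A i) ℂ :=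
  contract fun a r i ↦ (a i, r i)

theorem measureResource_tensorResource (K ρ : Matrix (∀ i, R i) (∀ i, R i) ℂ)
    (ω : Matrix (∀ i, A i) (∀ i, A i) ℂ) :
    measureResource K (tensorResource ρ ω) = (ρ * K).trace • ω := by
  ext a a'
  simp only [measureResource, contract_apply, tensorResource_apply, Matrix.smul_apply, trace,
    diag_apply, Matrix.mul_apply, Finset.sum_mul, smul_eq_mul]
  exact Finset.sum_congr rfl fun r _ ↦ Finset.sum_congr rfl fun r' _ ↦ by ring

theorem isCP_measureResource [∀ i, Finite (A i)] {K : Matrix (∀ i, R i) (∀ i, R i) ℂ}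
    (hK : 0 ≤ K) : IsCP (measureResource (A := A) K) :=
  isCP_contract _ hK.posSemidef

theorem partialTranspose_measureResource_partialTranspose (S : Finset ι)
    (K : Matrix (∀ i, R i) (∀ i, R i) ℂ) (X : Matrix (∀ i, A i × R i) (∀ i, A i × R i) ℂ) :
    partialTranspose S (measureResource K (partialTranspose S X)) =
      measureResource (partialTranspose S K) X := by
  rw [measureResource, partialTranspose_contract (fun _ ↦ Prod.mk),
    partialTranspose_partialTranspose]

theorem trace_measureResource_one [∀ i, Fintype (A i)] [∀ i, DecidableEq (R i)]
    (X : Matrix (∀ i, A i × R i) (∀ i, A i × R i) ℂ) : (measureResource 1 X).trace = X.trace :=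
  trace_contract_one (f := fun (a : ∀ i, A i) (r : ∀ i, R i) i ↦ (a i, r i))
    (Equiv.arrowProdEquivProdArrow ι A R).symm.bijective X

end Resource

section ResourceEffect

variable {ι : Type*} [Fintype ι] [DecidableEq ι] {A A' R : ι → Type*} [∀ i, Fintype (A i)]
  [∀ i, DecidableEq (A i)] [∀ i, Fintype (R i)] [∀ i, DecidableEq (R i)]
  {P : Matrix (∀ i, A i × R i) (∀ i, A i × R i) ℂ →ₗ[ℂ] Matrix (∀ i, A' i) (∀ i, A' i) ℂ}

theorem partyChoi_comp_tensorResource (ρ : Matrix (∀ i, R i) (∀ i, R i) ℂ) :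
    partyChoi (P ∘ₗ tensorResource ρ) =
      contract (fun z r i ↦ (((z i).1, r i), (z i).2)) ρᵀ (partyChoi P) := by
  ext z z'
  simp only [partyChoi_apply, LinearMap.comp_apply, tensorResource_single, map_sum, map_smul,
    Matrix.sum_apply, Matrix.smul_apply, contract_apply, transpose_apply, smul_eq_mul, mul_comm]

variable [∀ i, Fintype (A' i)]

/-- The effect on the resource systems that computes the overlap with `W` of the Choi matrix of the
simulated map, as stated in `trace_mul_resourceEffect`. -/
def resourceEffect
    (P : Matrix (∀ i, A i × R i) (∀ i, A i × R i) ℂ →ₗ[ℂ] Matrix (∀ i, A' i) (∀ i, A' i) ℂ) :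
    Matrix (∀ i, A i × A' i) (∀ i, A i × A' i) ℂ →ₗ[ℂ] Matrix (∀ i, R i) (∀ i, R i) ℂ :=
  (transposeLinearEquiv _ _ ℂ ℂ).toLinearMap ∘ₗ
    (contract fun r z i ↦ (((z i).1, r i), (z i).2)).flip (partyChoi P)

theorem resourceEffect_apply (W : Matrix (∀ i, A i × A' i) (∀ i, A i × A' i) ℂ) :
    resourceEffect P W =
      (contract (fun (r : ∀ i, R i) z i ↦ (((z i).1, r i), (z i).2)) W (partyChoi P))ᵀ := rfl

theorem trace_mul_resourceEffect (ρ : Matrix (∀ i, R i) (∀ i, R i) ℂ)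
    (W : Matrix (∀ i, A i × A' i) (∀ i, A i × A' i) ℂ) :
    (ρ * resourceEffect P W).trace = (partyChoi (P ∘ₗ tensorResource ρ) * W).trace := by
  rw [partyChoi_comp_tensorResource, trace_contract_mul, ← trace_transpose, transpose_mul,
    resourceEffect_apply, transpose_transpose]
  rfl

theorem resourceEffect_nonneg (hP : IsCP P) {W : Matrix (∀ i, A i × A' i) (∀ i, A i × A' i) ℂ}
    (hW : 0 ≤ W) : 0 ≤ resourceEffect P W := by
  rw [resourceEffect_apply]
  exact (posSemidef_contract _ hW.posSemidef
    ((isCP_iff_posSemidef_partyChoi P).1 hP)).transpose.nonneg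

theorem partialTranspose_resourceEffect (S : Finset ι)
    (W : Matrix (∀ i, A i × A' i) (∀ i, A i × A' i) ℂ) :
    partialTranspose S (resourceEffect P W) =
      resourceEffect (partialTranspose S ∘ₗ P ∘ₗ partialTranspose S) (partialTranspose S W) := by
  rw [resourceEffect_apply, resourceEffect_apply, partyChoi_partialTranspose_comp,
    ← partialTranspose_contract (A := R) (R := fun i ↦ A i × A' i) fun i r z ↦ ((z.1, r), z.2)]
  rfl

theorem resourceEffect_one [∀ i, DecidableEq (A' i)] (hP : ∀ X, (P X).trace = X.trace) :
    resourceEffect P 1 = (Fintype.card (∀ i, A i) : ℂ) • 1 := by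
  have hsum := (trace_preserving_iff_sum_choi P).1 hP
  ext r' r
  rw [resourceEffect_apply, transpose_apply, contract_apply]
  simp only [one_apply, mul_ite, mul_one, mul_zero, Finset.sum_ite_eq', Finset.mem_univ, if_true]
  have hentry (a : ∀ i, A i) : ∑ c, choi P (fun i ↦ (a i, r i), c) (fun i ↦ (a i, r' i), c) =
      (1 : Matrix (∀ i, R i) (∀ i, R i) ℂ) r' r := by
    have hiff : ((fun i ↦ (a i, r i) : ∀ i, A i × R i) = fun i ↦ (a i, r' i)) ↔ r' = r := by
      simp [funext_iff, eq_comm]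
    rw [hsum, one_apply, one_apply, if_congr hiff rfl rfl]
  calc ∑ z : ∀ i, A i × A' i, partyChoi P (fun i ↦ (((z i).1, r i), (z i).2))
        (fun i ↦ (((z i).1, r' i), (z i).2)) =
      ∑ p : (∀ i, A i) × (∀ i, A' i),
        choi P (fun i ↦ (p.1 i, r i), p.2) (fun i ↦ (p.1 i, r' i), p.2) :=
        (Equiv.arrowProdEquivProdArrow ι A A').sum_comp fun p ↦
          choi P (fun i ↦ (p.1 i, r i), p.2) (fun i ↦ (p.1 i, r' i), p.2)
    _ = ∑ _a : ∀ i, A i, (1 : Matrix (∀ i, R i) (∀ i, R i) ℂ) r' r :=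
        (Fintype.sum_prod_type _).trans (Finset.sum_congr rfl fun a _ ↦ hentry a)
    _ = (Fintype.card (∀ i, A i) : ℂ) * (1 : Matrix (∀ i, R i) (∀ i, R i) ℂ) r' r := by
        rw [Finset.sum_const, Finset.card_univ, nsmul_eq_mul]

end ResourceEffect

section Isotropic

variable (n : Type*) [DecidableEq n]

/-- The flip operator `∑ i j, |i⟩⟨j| ⊗ |j⟩⟨i|` of two copies of a system. -/
def flipOp : Matrix (n × n) (n × n) ℂ :=
  (1 : Matrix (n × n) (n × n) ℂ).submatrix id Prod.swap

/-- The transposition on the first factor of a bipartite system. -/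
def transposeFst {n : Type*} : Matrix (n × n) (n × n) ℂ →ₗ[ℂ] Matrix (n × n) (n × n) ℂ where
  toFun X := Matrix.of fun p q ↦ X (q.1, p.2) (p.1, q.2)
  map_add' _ _ := rfl
  map_smul' _ _ := rfl

theorem transposeFst_apply {n : Type*} (X : Matrix (n × n) (n × n) ℂ) (p q : n × n) :
    transposeFst X p q = X (q.1, p.2) (p.1, q.2) := rfl

theorem transposeFst_one : transposeFst (1 : Matrix (n × n) (n × n) ℂ) = 1 := by
  ext p q
  simp [transposeFst_apply, one_apply, Prod.ext_iff, eq_comm]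

theorem transposeFst_maxEnt : transposeFst (maxEnt n) = flipOp n := by
  ext p q
  simp [transposeFst_apply, flipOp, maxEnt_apply, one_apply, Prod.ext_iff, and_comm, eq_comm]

theorem transpose_maxEnt : (maxEnt n)ᵀ = maxEnt n := by
  ext p q
  simp only [transpose_apply, maxEnt_apply, and_comm]

theorem flipOp_conjTranspose : (flipOp n)ᴴ = flipOp n := by
  ext p q
  simp [flipOp, one_apply, Prod.ext_iff, and_comm, eq_comm]

theorem star_maxEntVec_dotProduct [Fintype n] :
    star (maxEntVec n) ⬝ᵥ maxEntVec n = Fintype.card n := by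
  rw [dotProduct, Fintype.sum_prod_type]
  simp [maxEntVec, one_apply]

theorem flipOp_mul_self [Fintype n] : flipOp n * flipOp n = 1 := by
  ext p q
  simp [flipOp, Matrix.mul_apply, one_apply]

/-- The orthogonal projections onto the maximally entangled state (`true`) and onto its orthogonal
complement (`false`), which span the isotropic operators. -/
def isotropicProj [Fintype n] : Bool → Matrix (n × n) (n × n) ℂ
  | true => (Fintype.card n : ℝ)⁻¹ • maxEnt n
  | false => 1 - (Fintype.card n : ℝ)⁻¹ • maxEnt n

/-- The rank of `isotropicProj`, as a function of the dimension. -/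
def isotropicRank (d : ℕ) : Bool → ℝ
  | true => 1
  | false => d ^ 2 - 1

/-- The Choi matrices of the identity channel (`true`) and of the uniform mixture of the other
generalized Pauli channels (`false`). In dimension one there are no such channels, and the division
by zero gives the Choi matrix `0`. -/
def isotropicChoi [Fintype n] (x : Bool) : Matrix (n × n) (n × n) ℂ :=
  (Fintype.card n / isotropicRank (Fintype.card n) x) • isotropicProj n x

/-- The projections onto the symmetric (`s = 1`) and the antisymmetric (`s = -1`) subspace. -/
def flipProj (s : ℤˣ) : Matrix (n × n) (n × n) ℂ :=
  (1 / 2 : ℝ) • (1 + ((s : ℤ) : ℝ) • flipOp n)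

theorem flipProj_nonneg [Finite n] (s : ℤˣ) : 0 ≤ flipProj n s := by
  have := Fintype.ofFinite n
  have hs : ((s : ℤ) : ℝ) * ((s : ℤ) : ℝ) = 1 := mod_cast Int.units_coe_mul_self s
  have hsq : (1 + ((s : ℤ) : ℝ) • flipOp n) * (1 + ((s : ℤ) : ℝ) • flipOp n) =
      (2 : ℝ) • (1 + ((s : ℤ) : ℝ) • flipOp n) := by
    simp only [Matrix.add_mul, Matrix.mul_add, Matrix.one_mul, Matrix.mul_one, Matrix.smul_mul,
      Matrix.mul_smul, flipOp_mul_self]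
    match_scalars
    · linear_combination hs
    · ring
  have hproj : IsStarProjection (flipProj n s) := by
    refine ⟨?_, ?_⟩
    · rw [IsIdempotentElem, flipProj, Matrix.smul_mul, Matrix.mul_smul, hsq]
      module
    · rw [isSelfAdjoint_iff, flipProj, star_smul, star_add, star_smul, star_one,
        star_eq_conjTranspose, flipOp_conjTranspose, star_trivial, star_trivial]
  exact hproj.nonneg

/-- The coefficients of the expansion of a partially transposed isotropic operator in the
projections `flipProj`, see `transposeFst_isotropicChoi`. -/
def signWeight (d : ℕ) (s : ℤˣ) : Bool → ℝ
  | true => (s : ℤ)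
  | false => 1 / (d + (s : ℤ))

variable [Fintype n]

theorem isotropicProj_nonneg [Nonempty n] (x : Bool) : 0 ≤ isotropicProj n x := by
  have hidem : maxEnt n * maxEnt n = (Fintype.card n : ℝ) • maxEnt n := by
    rw [maxEnt, vecMulVec_mul_vecMulVec, star_maxEntVec_dotProduct, vecMulVec_smul]
    ext
    simp
  have hproj : IsStarProjection (isotropicProj n true) := by
    refine ⟨?_, ?_⟩
    · rw [IsIdempotentElem, isotropicProj, Matrix.smul_mul, Matrix.mul_smul, hidem, smul_smul,
        smul_smul, mul_assoc, inv_mul_cancel₀ (Nat.cast_ne_zero.2 Fintype.card_ne_zero), mul_one]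
    · exact ((posSemidef_vecMulVec_self_star _).smul (by positivity)).isHermitian
  cases x
  exacts [hproj.one_sub.nonneg, hproj.nonneg]

theorem sum_isotropicProj : ∑ x, isotropicProj n x = 1 := by
  simp [isotropicProj]

theorem transpose_isotropicProj (x : Bool) : (isotropicProj n x)ᵀ = isotropicProj n x := by
  cases x <;> simp [isotropicProj, transpose_maxEnt]

theorem isotropicRank_pos {d : ℕ} (hd : 2 ≤ d) (x : Bool) : 0 < isotropicRank d x := by
  have : (2 : ℝ) ≤ d := mod_cast hd
  cases x <;> simp only [isotropicRank] <;> nlinarith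

theorem transpose_isotropicChoi (x : Bool) : (isotropicChoi n x)ᵀ = isotropicChoi n x := by
  rw [isotropicChoi, transpose_smul, transpose_isotropicProj]

theorem isotropicChoi_nonneg (hn : 2 ≤ Fintype.card n) (x : Bool) : 0 ≤ isotropicChoi n x := by
  have : Nonempty n := Fintype.card_pos_iff.1 (by lia)
  have := isotropicRank_pos hn x
  exact ((isotropicProj_nonneg n x).posSemidef.smul (by positivity)).nonneg

theorem isotropicChoi_true [Nonempty n] : isotropicChoi n true = maxEnt n := by
  rw [isotropicChoi, isotropicProj, isotropicRank, div_one, smul_inv_smul₀ (by positivity)]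

theorem sum_isotropicChoi (hn : 2 ≤ Fintype.card n) (x : Bool) (i i' : n) :
    ∑ j, isotropicChoi n x (i, j) (i', j) = (1 : Matrix n n ℂ) i i' := by
  have : Nonempty n := Fintype.card_pos_iff.1 (by lia)
  have hmaxEnt : ∑ j, maxEnt n (i, j) (i', j) = (1 : Matrix n n ℂ) i i' := by
    simp [maxEnt_apply, one_apply, ite_and, eq_comm]
  have hone : ∑ j, (1 : Matrix (n × n) (n × n) ℂ) (i, j) (i', j) =
      Fintype.card n * (1 : Matrix n n ℂ) i i' := by
    simp [one_apply]
  have hrank : ((isotropicRank (Fintype.card n) false : ℝ) : ℂ) ≠ 0 :=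
    mod_cast (isotropicRank_pos hn false).ne'
  cases x
  · simp only [isotropicChoi, isotropicProj, Matrix.smul_apply, Matrix.sub_apply,
      Complex.real_smul, ← Finset.mul_sum, Finset.sum_sub_distrib, hone, hmaxEnt]
    simp only [isotropicRank] at hrank ⊢
    push_cast at hrank ⊢
    field_simp
  · rw [isotropicChoi_true, hmaxEnt]

theorem transposeFst_isotropicProj (x : Bool) : transposeFst (isotropicProj n x) =
    bif x then (Fintype.card n : ℝ)⁻¹ • flipOp n else 1 - (Fintype.card n : ℝ)⁻¹ • flipOp n := by
  cases x <;> simp only [isotropicProj, map_sub, LinearMap.map_smul_of_tower, transposeFst_one,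
    transposeFst_maxEnt, cond_true, cond_false]

theorem sum_signWeight_smul_transposeFst_isotropicProj (hn : 2 ≤ Fintype.card n) (s : ℤˣ) :
    ∑ x, signWeight (Fintype.card n) s x • transposeFst (isotropicProj n x) =
      (2 / (Fintype.card n + (s : ℤ)) : ℝ) • flipProj n s := by
  have hcard : (2 : ℝ) ≤ Fintype.card n := mod_cast hn
  have hadd : (Fintype.card n + 1 : ℝ) ≠ 0 := by positivity
  have hsub : (Fintype.card n + -1 : ℝ) ≠ 0 := by linarith
  simp only [Fintype.sum_bool, transposeFst_isotropicProj, signWeight, flipProj, cond_true,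
    cond_false]
  rcases Int.units_eq_one_or s with rfl | rfl
  · simp only [Units.val_one, Int.cast_one, one_smul]
    match_scalars
    all_goals field_simp; try ring
  · simp only [Units.val_neg, Units.val_one, Int.cast_neg, Int.cast_one, neg_smul, one_smul]
    match_scalars
    all_goals field_simp; try ring

theorem transposeFst_isotropicChoi (hn : 2 ≤ Fintype.card n) (x : Bool) :
    transposeFst (isotropicChoi n x) =
      ∑ s, signWeight (Fintype.card n) s x • flipProj n s := by
  have hcard : (2 : ℝ) ≤ Fintype.card n := mod_cast hn
  have hadd : (Fintype.card n + 1 : ℝ) ≠ 0 := by positivity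
  have hsub : (Fintype.card n + -1 : ℝ) ≠ 0 := by linarith
  have hrank : (Fintype.card n ^ 2 - 1 : ℝ) ≠ 0 := (isotropicRank_pos hn false).ne'
  rw [isotropicChoi, LinearMap.map_smul_of_tower, transposeFst_isotropicProj,
    show (Finset.univ : Finset ℤˣ) = {1, -1} from rfl, Finset.sum_pair (by decide)]
  cases x <;> simp only [isotropicRank, signWeight, flipProj, cond_true, cond_false, Units.val_one,
    Int.cast_one, one_smul, Units.val_neg, Int.cast_neg, neg_smul]
  · match_scalars
    all_goals field_simp; try ring
  · match_scalars
    all_goals field_simp; try ring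

end Isotropic

section SwapSystems

open scoped Kronecker

variable (d : ℕ)

/-- Without Charlie's trivial system, the joint system is a pair of `d`-dimensional systems. -/
def swapSysEquiv : (∀ p, SwapSys d p) ≃ Fin d × Fin d where
  toFun x := (x .alice, x .bob)
  invFun q
    | .alice => q.1
    | .bob => q.2
    | .charlie => (0 : Fin 1)
  left_inv x := by
    funext p
    cases p
    exacts [rfl, rfl, Subsingleton.elim (α := Fin 1) _ _]
  right_inv _ := rfl

theorem card_swapSys : Fintype.card (∀ p, SwapSys d p) = d ^ 2 := by
  rw [Fintype.card_congr (swapSysEquiv d), Fintype.card_prod, Fintype.card_fin, sq]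

/-- Groups the labels on the Choi matrix of a channel on the swap systems into Alice's input with
Bob's output, and Bob's input with Alice's output. -/
def swapPairs (z : ∀ p, SwapSys d p × SwapSys d p) : (Fin d × Fin d) × (Fin d × Fin d) :=
  (((z .alice).1, (z .bob).2), ((z .bob).1, (z .alice).2))

theorem swapPairs_injective : Function.Injective (swapPairs d) := by
  intro z w h
  obtain ⟨⟨hA, hB'⟩, hB, hA'⟩ := (Prod.mk.inj h).imp Prod.mk.inj Prod.mk.inj
  funext p
  cases p
  exacts [Prod.ext hA hA', Prod.ext hB hB', Subsingleton.elim (α := Fin 1 × Fin 1) _ _]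

/-- The Choi matrix of the channel that sends Alice's input to Bob's output by the map with Choi
matrix `g`, and Bob's input to Alice's output by the map with Choi matrix `h`. -/
def swapTensor : Matrix (Fin d × Fin d) (Fin d × Fin d) ℂ →ₗ[ℂ]
    Matrix (Fin d × Fin d) (Fin d × Fin d) ℂ →ₗ[ℂ]
    Matrix (∀ p, SwapSys d p × SwapSys d p) (∀ p, SwapSys d p × SwapSys d p) ℂ :=
  LinearMap.mk₂ ℂ (fun g h ↦ (g ⊗ₖ h).submatrix (swapPairs d) (swapPairs d))
    (fun _ _ _ ↦ by rw [add_kronecker]; rfl) (fun _ _ _ ↦ by rw [smul_kronecker]; rfl)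
    (fun _ _ _ ↦ by rw [kronecker_add]; rfl) (fun _ _ _ ↦ by rw [kronecker_smul]; rfl)

variable {d}

theorem swapTensor_apply (g h : Matrix (Fin d × Fin d) (Fin d × Fin d) ℂ)
    (z w : ∀ p, SwapSys d p × SwapSys d p) : swapTensor d g h z w =
      g (swapPairs d z).1 (swapPairs d w).1 * h (swapPairs d z).2 (swapPairs d w).2 := rfl

theorem swapTensor_one : swapTensor d 1 1 = 1 := by
  change (1 ⊗ₖ 1).submatrix (swapPairs d) (swapPairs d) = 1
  rw [one_kronecker_one, submatrix_one _ (swapPairs_injective d)]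

theorem swapTensor_nonneg {g h : Matrix (Fin d × Fin d) (Fin d × Fin d) ℂ} (hg : 0 ≤ g)
    (hh : 0 ≤ h) : 0 ≤ swapTensor d g h :=
  ((hg.posSemidef.kronecker hh.posSemidef).submatrix (swapPairs d)).nonneg

theorem swapTensor_sum_smul {κ : Type*} [Fintype κ] (a b : κ → ℝ)
    (g h : κ → Matrix (Fin d × Fin d) (Fin d × Fin d) ℂ) :
    swapTensor d (∑ i, a i • g i) (∑ j, b j • h j) =
      ∑ i : κ × κ, (a i.1 * b i.2) • swapTensor d (g i.1) (h i.2) := by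
  simp only [map_sum, LinearMap.sum_apply, LinearMap.map_smul_of_tower, LinearMap.smul_apply,
    Fintype.sum_prod_type, mul_smul]
  rw [Finset.sum_comm]

theorem partialTranspose_swapTensor {g h : Matrix (Fin d × Fin d) (Fin d × Fin d) ℂ}
    (hg : gᵀ = g) (hh : hᵀ = h) {p : Party} (hp : p ∈ ({.alice, .bob} : Set Party)) :
    partialTranspose {p} (swapTensor d g h) =
      swapTensor d (transposeFst g) (transposeFst h) := by
  ext z w
  rcases hp with rfl | rfl
  · conv_rhs => rw [← hh]
    simp [partialTranspose_apply, swapTensor_apply, transposeFst_apply, swapPairs]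
  · conv_rhs => rw [← hg]
    simp [partialTranspose_apply, swapTensor_apply, transposeFst_apply, swapPairs]

theorem partialTranspose_charlie_swapTensor
    (g h : Matrix (Fin d × Fin d) (Fin d × Fin d) ℂ) :
    partialTranspose {Party.charlie} (swapTensor d g h) = swapTensor d g h := by
  ext z w
  rw [partialTranspose_apply, swapTensor_apply, swapTensor_apply]
  simp [swapPairs]

theorem choi_swapChannel : choi (swapChannel d) =
    vecMulVec (fun q ↦ swapOp d q.2 q.1) (star fun q ↦ swapOp d q.2 q.1) := by
  ext p q
  simp only [choi_apply, swapChannel, LinearMap.coe_mk, AddHom.coe_mk]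
  simp [Matrix.mul_apply, single_apply, vecMulVec_apply, ite_and]

theorem partyChoi_swapChannel :
    partyChoi (swapChannel d) = swapTensor d (maxEnt (Fin d)) (maxEnt (Fin d)) := by
  have hswap (z : ∀ p, SwapSys d p × SwapSys d p) :
      swapOp d (fun p ↦ (z p).2) (fun p ↦ (z p).1) =
        maxEntVec (Fin d) (swapPairs d z).1 * maxEntVec (Fin d) (swapPairs d z).2 := by
    have hflip : (fun p ↦ (z p).2) = flipLabel d (fun p ↦ (z p).1) ↔
        (swapPairs d z).1.1 = (swapPairs d z).1.2 ∧ (swapPairs d z).2.1 = (swapPairs d z).2.2 := by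
      rw [← (swapSysEquiv d).injective.eq_iff, Prod.ext_iff, and_comm]
      exact and_congr eq_comm eq_comm
    simp only [swapOp, of_apply, hflip, maxEntVec, one_apply, ite_zero_mul_ite_zero, mul_one]
  ext z w
  change choi (swapChannel d) (fun p ↦ (z p).1, fun p ↦ (z p).2)
    (fun p ↦ (w p).1, fun p ↦ (w p).2) = _
  rw [choi_swapChannel, vecMulVec_apply, Pi.star_apply, hswap, hswap, swapTensor_apply,
    maxEnt, vecMulVec_apply, vecMulVec_apply, star_mul', mul_mul_mul_comm]
  rfl

/-- The channel that applies, to either of the two swapped systems, the identity (for the label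
`true`) or the uniform mixture of the other generalized Pauli channels (for `false`). -/
def isotropicSwap (d : ℕ) (x : Bool × Bool) :
    Matrix (∀ p, SwapSys d p) (∀ p, SwapSys d p) ℂ →ₗ[ℂ]
    Matrix (∀ p, SwapSys d p) (∀ p, SwapSys d p) ℂ :=
  partyChoi.symm (swapTensor d (isotropicChoi (Fin d) x.1) (isotropicChoi (Fin d) x.2))

theorem partyChoi_isotropicSwap (x : Bool × Bool) : partyChoi (isotropicSwap d x) =
    swapTensor d (isotropicChoi (Fin d) x.1) (isotropicChoi (Fin d) x.2) :=
  partyChoi.apply_symm_apply _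

theorem isotropicSwap_true [NeZero d] : isotropicSwap d (true, true) = swapChannel d := by
  rw [isotropicSwap, isotropicChoi_true, ← partyChoi_swapChannel, LinearEquiv.symm_apply_apply]

theorem isChannel_isotropicSwap (hd : 2 ≤ d) (x : Bool × Bool) :
    IsChannel (isotropicSwap d x) := by
  have hcard : 2 ≤ Fintype.card (Fin d) := by rwa [Fintype.card_fin]
  refine ⟨(isCP_iff_posSemidef_partyChoi _).2 ?_, (trace_preserving_iff_sum_choi _).2 ?_⟩
  · rw [partyChoi_isotropicSwap]
    exact (swapTensor_nonneg (isotropicChoi_nonneg _ hcard _)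
      (isotropicChoi_nonneg _ hcard _)).posSemidef
  · intro c c'
    let e := swapSysEquiv d
    have hsum : ∑ y, choi (isotropicSwap d x) (c, y) (c', y) =
        ∑ q : Fin d × Fin d, isotropicChoi (Fin d) x.1 ((e c).1, q.2) ((e c').1, q.2) *
          isotropicChoi (Fin d) x.2 ((e c).2, q.1) ((e c').2, q.1) := by
      rw [← e.sum_comp]
      exact Finset.sum_congr rfl fun y _ ↦
        congr_fun₂ (partyChoi_isotropicSwap x) (fun p ↦ (c p, y p)) fun p ↦ (c' p, y p)
    rw [hsum, Fintype.sum_prod_type_right]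
    simp only [← Finset.mul_sum, ← Finset.sum_mul, sum_isotropicChoi _ hcard]
    change ((1 ⊗ₖ 1).submatrix e e : Matrix _ _ ℂ) c c' = _
    rw [one_kronecker_one, submatrix_one_equiv]

end SwapSystems

section SwapFamily

variable {d : ℕ} {R : Party → Type*} [∀ p, Fintype (R p)] [∀ p, DecidableEq (R p)]

/-- A family of operators `X x` is feasible if it is a measurement, and `X x` as well as its
signed combinations have positive partial transposes. It is `SwapFeasible` in a form that is uniform
in the labels: `K`, `L`, `M` and `N` have the labels `(true, true)`, `(true, false)`,
`(false, true)` and `(false, false)`. -/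
structure IsSwapFamily (d : ℕ) (X : Bool × Bool → Matrix (∀ p, R p) (∀ p, R p) ℂ) : Prop where
  nonneg : ∀ x, 0 ≤ X x
  sum_eq_one : ∑ x, X x = 1
  ppt : ∀ p ∈ ({.alice, .bob} : Set Party), ∀ s t : ℤˣ,
    0 ≤ partialTranspose {p} (∑ x, (signWeight d s x.1 * signWeight d t x.2) • X x)
  ppt_charlie : ∀ x, 0 ≤ partialTranspose {Party.charlie} (X x)

theorem forall_signWeight_ppt_iff {ι : Type*} [DecidableEq ι] {R : ι → Type*} (S : Finset ι)
    (X : Bool × Bool → Matrix (∀ p, R p) (∀ p, R p) ℂ) :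
    (∀ s t : ℤˣ, 0 ≤ partialTranspose S
      (∑ x, (signWeight d s x.1 * signWeight d t x.2) • X x)) ↔
    0 ≤ partialTranspose S (X (true, true) + (1 / ((d : ℝ) + 1)) • X (true, false) +
      (1 / ((d : ℝ) + 1)) • X (false, true) + (1 / ((d : ℝ) + 1) ^ 2) • X (false, false)) ∧
    partialTranspose S (X (true, true) + (1 / ((d : ℝ) + 1)) • X (false, true)) ≤
      (1 / ((d : ℝ) - 1)) • partialTranspose S
        (X (true, false) + (1 / ((d : ℝ) + 1)) • X (false, false)) ∧
    partialTranspose S (X (true, true) + (1 / ((d : ℝ) + 1)) • X (true, false)) ≤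
      (1 / ((d : ℝ) - 1)) • partialTranspose S
        (X (false, true) + (1 / ((d : ℝ) + 1)) • X (false, false)) ∧
    (1 / ((d : ℝ) - 1)) • partialTranspose S (X (true, false) + X (false, true)) ≤
      partialTranspose S (X (true, true) + (1 / ((d : ℝ) - 1) ^ 2) • X (false, false)) := by
  have hunits (Q : ℤˣ → ℤˣ → Prop) :
      (∀ s t, Q s t) ↔ Q 1 1 ∧ Q 1 (-1) ∧ Q (-1) 1 ∧ Q (-1) (-1) := by
    refine ⟨fun h ↦ ⟨h _ _, h _ _, h _ _, h _ _⟩, fun ⟨h₁, h₂, h₃, h₄⟩ s t ↦ ?_⟩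
    rcases Int.units_eq_one_or s with rfl | rfl <;> rcases Int.units_eq_one_or t with rfl | rfl <;>
      assumption
  have hle (Y Z : Matrix (∀ p, R p) (∀ p, R p) ℂ) :
      partialTranspose S Y ≤ partialTranspose S Z ↔ 0 ≤ partialTranspose S (Z - Y) := by
    rw [map_sub, sub_nonneg]
  simp only [hunits, ← LinearMap.map_smul_of_tower, hle, Fintype.sum_prod_type, Fintype.sum_bool,
    signWeight, Units.val_one, Units.val_neg, Int.cast_one, Int.cast_neg, ← sub_eq_add_neg,
    ← _root_.one_div_pow]
  refine and_congr ?_ (and_congr ?_ (and_congr ?_ ?_)) <;>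
    exact iff_of_eq (congrArg (fun Y ↦ 0 ≤ partialTranspose S Y) (by module))

theorem isSwapFamily_iff (X : Bool × Bool → Matrix (∀ p, R p) (∀ p, R p) ℂ) :
    IsSwapFamily d X ↔ SwapFeasible d (X (true, true)) (X (true, false)) (X (false, true))
      (X (false, false)) := by
  constructor
  · rintro ⟨hnonneg, hsum, hppt, hcharlie⟩
    have hppt' p hp := (forall_signWeight_ppt_iff _ X).1 (hppt p hp)
    rw [Fintype.sum_prod_type, Fintype.sum_bool, Fintype.sum_bool, Fintype.sum_bool,
      ← add_assoc] at hsum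
    exact ⟨hnonneg _, hnonneg _, hnonneg _, hnonneg _, hsum, fun p hp ↦ (hppt' p hp).1,
      fun p hp ↦ (hppt' p hp).2.1, fun p hp ↦ (hppt' p hp).2.2.1, fun p hp ↦ (hppt' p hp).2.2.2,
      hcharlie _, hcharlie _, hcharlie _, hcharlie _⟩
  · intro h
    refine ⟨?_, ?_, fun p hp ↦ (forall_signWeight_ppt_iff _ X).2
      ⟨h.ppt_one p hp, h.ppt_two p hp, h.ppt_three p hp, h.ppt_four p hp⟩, ?_⟩
    · rintro ⟨_ | _, _ | _⟩
      exacts [h.nonneg_N, h.nonneg_M, h.nonneg_L, h.nonneg_K]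
    · rw [Fintype.sum_prod_type, Fintype.sum_bool, Fintype.sum_bool, Fintype.sum_bool, ← add_assoc]
      exact h.sum_eq_one
    · rintro ⟨_ | _, _ | _⟩
      exacts [h.ppt_charlie_N, h.ppt_charlie_M, h.ppt_charlie_L, h.ppt_charlie_K]

end SwapFamily

section Twirling

variable {d : ℕ} {R : Party → Type*} [∀ p, Fintype (R p)] [∀ p, DecidableEq (R p)]
  {P : Matrix (∀ p, SwapSys d p × R p) (∀ p, SwapSys d p × R p) ℂ →ₗ[ℂ]
    Matrix (∀ p, SwapSys d p) (∀ p, SwapSys d p) ℂ}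

/-- The measurement on the resource systems that a simulation `P` of the swap channel induces, with
one effect for each pair of isotropic projections on the Choi matrix of the simulated channel. -/
def swapEffects (P : Matrix (∀ p, SwapSys d p × R p) (∀ p, SwapSys d p × R p) ℂ →ₗ[ℂ]
    Matrix (∀ p, SwapSys d p) (∀ p, SwapSys d p) ℂ) (x : Bool × Bool) :
    Matrix (∀ p, R p) (∀ p, R p) ℂ :=
  ((d : ℝ) ^ 2)⁻¹ •
    resourceEffect P (swapTensor d (isotropicProj (Fin d) x.1) (isotropicProj (Fin d) x.2))

theorem sum_smul_swapEffects (a b : Bool → ℝ) :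
    ∑ x, (a x.1 * b x.2) • swapEffects P x = ((d : ℝ) ^ 2)⁻¹ • resourceEffect P
      (swapTensor d (∑ i, a i • isotropicProj (Fin d) i) (∑ j, b j • isotropicProj (Fin d) j)) := by
  rw [swapTensor_sum_smul]
  simp only [map_sum, LinearMap.map_smul_of_tower, Finset.smul_sum,
    swapEffects, smul_comm (a _ * b _)]

theorem smul_resourceEffect_nonneg (hP : IsCP P)
    {g h : Matrix (Fin d × Fin d) (Fin d × Fin d) ℂ} (hg : 0 ≤ g) (hh : 0 ≤ h) {c : ℝ}
    (hc : 0 ≤ c) : 0 ≤ c • resourceEffect P (swapTensor d g h) :=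
  ((resourceEffect_nonneg hP (swapTensor_nonneg hg hh)).posSemidef.smul hc).nonneg

theorem isSwapFamily_swapEffects (hd : 2 ≤ d) (hP : IsCPPTP P) :
    IsSwapFamily d (swapEffects P) := by
  have : NeZero d := ⟨by lia⟩
  have hd' : (2 : ℝ) ≤ d := mod_cast hd
  have hcard : 2 ≤ Fintype.card (Fin d) := by rwa [Fintype.card_fin]
  have hproj x := isotropicProj_nonneg (Fin d) x
  let signedProj (s : ℤˣ) := ∑ i, signWeight d s i • isotropicProj (Fin d) i
  have htranspose (s : ℤˣ) : (signedProj s)ᵀ = signedProj s := by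
    simp only [signedProj, transpose_sum, transpose_smul, transpose_isotropicProj]
  have hsigned (s : ℤˣ) : 0 ≤ transposeFst (signedProj s) := by
    have hpos : (0 : ℝ) ≤ d + (s : ℤ) := by
      rcases Int.units_eq_one_or s with rfl | rfl <;> push_cast <;> linarith
    have hsum := sum_signWeight_smul_transposeFst_isotropicProj (Fin d) hcard s
    rw [Fintype.card_fin] at hsum
    simp only [signedProj, map_sum, LinearMap.map_smul_of_tower, hsum]
    exact ((flipProj_nonneg _ s).posSemidef.smul (by positivity)).nonneg
  refine ⟨fun x ↦ ?_, ?_, fun p hp s t ↦ ?_, fun x ↦ ?_⟩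
  · exact smul_resourceEffect_nonneg hP.1.1 (hproj _) (hproj _) (by positivity)
  · have hsum := sum_smul_swapEffects (P := P) 1 1
    simp only [Pi.one_apply, mul_one, one_smul, sum_isotropicProj, swapTensor_one,
      resourceEffect_one hP.1.2, card_swapSys] at hsum
    rw [hsum, ← Complex.coe_smul, smul_smul]
    push_cast
    rw [inv_mul_cancel₀ (by positivity), one_smul]
  · rw [sum_smul_swapEffects, LinearMap.map_smul_of_tower, partialTranspose_resourceEffect,
      partialTranspose_swapTensor (htranspose s) (htranspose t) hp]
    exact smul_resourceEffect_nonneg (hP.2 _) (hsigned s) (hsigned t) (by positivity)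
  · rw [swapEffects, LinearMap.map_smul_of_tower, partialTranspose_resourceEffect,
      partialTranspose_charlie_swapTensor]
    exact smul_resourceEffect_nonneg (hP.2 _) (hproj _) (hproj _) (by positivity)

theorem trace_mul_swapEffects (ρ : Matrix (∀ p, R p) (∀ p, R p) ℂ) :
    (ρ * swapEffects P (true, true)).trace.re =
      (choi (P ∘ₗ tensorResource ρ) * choi (swapChannel d)).trace.re /
        Fintype.card (∀ p, SwapSys d p) ^ 2 := by
  simp only [swapEffects, isotropicProj, LinearMap.map_smul_of_tower, LinearMap.smul_apply,
    smul_smul, Matrix.mul_smul, trace_smul, trace_mul_resourceEffect, partyChoi_swapChannel,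
    ← trace_partyChoi_mul, Complex.smul_re, card_swapSys, Fintype.card_fin, smul_eq_mul]
  push_cast
  ring

end Twirling

section Simulation

variable {d : ℕ} {R : Party → Type*} [∀ p, Fintype (R p)]

/-- The simulation that measures the resource systems with the effects `X x` and, on outcome `x`,
applies the channel `isotropicSwap d x`. -/
def swapSimulation (d : ℕ) (X : Bool × Bool → Matrix (∀ p, R p) (∀ p, R p) ℂ) :
    Matrix (∀ p, SwapSys d p × R p) (∀ p, SwapSys d p × R p) ℂ →ₗ[ℂ]
    Matrix (∀ p, SwapSys d p) (∀ p, SwapSys d p) ℂ :=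
  ∑ x, isotropicSwap d x ∘ₗ measureResource (X x)

variable {X : Bool × Bool → Matrix (∀ p, R p) (∀ p, R p) ℂ}

theorem partialTranspose_comp_swapSimulation (S : Finset Party) :
    partialTranspose S ∘ₗ swapSimulation d X ∘ₗ partialTranspose S =
      ∑ x, (partialTranspose S ∘ₗ isotropicSwap d x ∘ₗ partialTranspose S) ∘ₗ
        measureResource (partialTranspose S (X x)) := by
  refine LinearMap.ext fun Y ↦ ?_
  simp only [swapSimulation, LinearMap.comp_apply, LinearMap.sum_apply, map_sum,
    ← partialTranspose_measureResource_partialTranspose, partialTranspose_partialTranspose]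

/-- The map with Choi matrix `flipProj u.1 ⊗ flipProj u.2`, grouped as in `swapTensor`. -/
def flipSwap (d : ℕ) (u : ℤˣ × ℤˣ) : Matrix (∀ p, SwapSys d p) (∀ p, SwapSys d p) ℂ →ₗ[ℂ]
    Matrix (∀ p, SwapSys d p) (∀ p, SwapSys d p) ℂ :=
  partyChoi.symm (swapTensor d (flipProj (Fin d) u.1) (flipProj (Fin d) u.2))

theorem isCP_flipSwap (u : ℤˣ × ℤˣ) : IsCP (flipSwap d u) := by
  rw [isCP_iff_posSemidef_partyChoi, flipSwap, LinearEquiv.apply_symm_apply]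
  exact (swapTensor_nonneg (flipProj_nonneg _ _) (flipProj_nonneg _ _)).posSemidef

theorem partialTranspose_comp_isotropicSwap (hd : 2 ≤ d) {p : Party}
    (hp : p ∈ ({.alice, .bob} : Set Party)) (x : Bool × Bool) :
    partialTranspose {p} ∘ₗ isotropicSwap d x ∘ₗ partialTranspose {p} =
      ∑ u : ℤˣ × ℤˣ, (signWeight d u.1 x.1 * signWeight d u.2 x.2) • flipSwap d u := by
  have hcard : 2 ≤ Fintype.card (Fin d) := by rwa [Fintype.card_fin]
  have hsmul (c : ℝ) (u : ℤˣ × ℤˣ) : partyChoi (c • flipSwap d u) =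
      c • swapTensor d (flipProj (Fin d) u.1) (flipProj (Fin d) u.2) := by
    rw [← LinearEquiv.coe_coe, LinearMap.map_smul_of_tower, LinearEquiv.coe_coe, flipSwap,
      LinearEquiv.apply_symm_apply]
  apply partyChoi.injective
  rw [partyChoi_partialTranspose_comp, partyChoi_isotropicSwap,
    partialTranspose_swapTensor (transpose_isotropicChoi _ _) (transpose_isotropicChoi _ _) hp,
    transposeFst_isotropicChoi _ hcard, transposeFst_isotropicChoi _ hcard, swapTensor_sum_smul,
    map_sum]
  simp only [hsmul, Fintype.card_fin]

theorem partialTranspose_charlie_comp_isotropicSwap (x : Bool × Bool) :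
    partialTranspose {Party.charlie} ∘ₗ isotropicSwap d x ∘ₗ partialTranspose {Party.charlie} =
      isotropicSwap d x := by
  apply partyChoi.injective
  rw [partyChoi_partialTranspose_comp, partyChoi_isotropicSwap,
    partialTranspose_charlie_swapTensor]

variable [∀ p, DecidableEq (R p)]

theorem IsSwapFamily.isChannel_swapSimulation (hd : 2 ≤ d) (hX : IsSwapFamily d X) :
    IsChannel (swapSimulation d X) := by
  refine ⟨IsCP.sum _ fun x _ ↦ (isChannel_isotropicSwap hd x).1.comp
    (isCP_measureResource (hX.nonneg x)), fun Y ↦ ?_⟩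
  simp only [swapSimulation, LinearMap.sum_apply, LinearMap.comp_apply, trace_sum,
    (isChannel_isotropicSwap hd _).2]
  rw [← trace_sum, ← LinearMap.sum_apply, ← map_sum, hX.sum_eq_one, trace_measureResource_one]

theorem IsSwapFamily.isCP_partialTranspose_comp_swapSimulation (hd : 2 ≤ d)
    (hX : IsSwapFamily d X) {p : Party} (hp : p ∈ ({.alice, .bob} : Set Party)) :
    IsCP (partialTranspose {p} ∘ₗ swapSimulation d X ∘ₗ partialTranspose {p}) := by
  have hsum : partialTranspose {p} ∘ₗ swapSimulation d X ∘ₗ partialTranspose {p} =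
      ∑ u : ℤˣ × ℤˣ, flipSwap d u ∘ₗ measureResource (partialTranspose {p}
        (∑ x, (signWeight d u.1 x.1 * signWeight d u.2 x.2) • X x)) := by
    rw [partialTranspose_comp_swapSimulation]
    refine LinearMap.ext fun Y ↦ ?_
    simp only [partialTranspose_comp_isotropicSwap hd hp, LinearMap.sum_apply,
      LinearMap.comp_apply, LinearMap.smul_apply, map_sum, LinearMap.map_smul_of_tower]
    rw [Finset.sum_comm]
  rw [hsum]
  exact IsCP.sum _ fun u _ ↦ (isCP_flipSwap u).comp (isCP_measureResource (hX.ppt p hp u.1 u.2))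

theorem IsSwapFamily.isCPPTP_swapSimulation (hd : 2 ≤ d) (hX : IsSwapFamily d X) :
    IsCPPTP (swapSimulation d X) := by
  refine isCPPTP_of_forall_singleton (hX.isChannel_swapSimulation hd) fun p ↦ ?_
  cases p with
  | alice => exact hX.isCP_partialTranspose_comp_swapSimulation hd (.inl rfl)
  | bob => exact hX.isCP_partialTranspose_comp_swapSimulation hd (.inr rfl)
  | charlie =>
    simp only [partialTranspose_comp_swapSimulation, partialTranspose_charlie_comp_isotropicSwap]
    exact IsCP.sum _ fun x _ ↦ (isChannel_isotropicSwap hd x).1.comp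
      (isCP_measureResource (hX.ppt_charlie x))

theorem IsSwapFamily.isCP_swapSimulation_sub (hd : 2 ≤ d) (hX : IsSwapFamily d X)
    {ρ : Matrix (∀ p, R p) (∀ p, R p) ℂ} (hρ : IsState ρ) :
    IsCP (swapSimulation d X ∘ₗ tensorResource ρ -
      (ρ * X (true, true)).trace.re • swapChannel d) := by
  have : NeZero d := ⟨by lia⟩
  have htrace : (ρ * X (true, true)).trace = ((ρ * X (true, true)).trace.re : ℂ) :=
    Complex.eq_re_of_ofReal_le (r := 0) (trace_mul_nonneg hρ.1.nonneg (hX.nonneg _))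
  have hswap : (isotropicSwap d (true, true) ∘ₗ measureResource (X (true, true))) ∘ₗ
      tensorResource ρ = (ρ * X (true, true)).trace.re • swapChannel d := by
    rw [← algebraMap_smul ℂ, Complex.coe_algebraMap, ← htrace, isotropicSwap_true]
    refine LinearMap.ext fun ω ↦ ?_
    simp only [LinearMap.comp_apply, measureResource_tensorResource, map_smul,
      LinearMap.smul_apply]
  have hsum : swapSimulation d X ∘ₗ tensorResource ρ =
      ∑ x, (isotropicSwap d x ∘ₗ measureResource (X x)) ∘ₗ tensorResource ρ :=
    LinearMap.ext fun ω ↦ by simp only [swapSimulation, LinearMap.comp_apply, LinearMap.sum_apply]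
  rw [hsum, ← hswap, ← Finset.sum_erase_eq_sub
    (f := fun x ↦ (isotropicSwap d x ∘ₗ measureResource (X x)) ∘ₗ tensorResource ρ)
    (Finset.mem_univ (true, true))]
  exact IsCP.sum _ fun x _ ↦ ((isChannel_isotropicSwap hd x).1.comp
    (isCP_measureResource (hX.nonneg x))).comp (isChannel_tensorResource hρ).1

end Simulation

section Value

theorem csInf_eq_one_sub_csSup {E V : Set ℝ} (hV : V.Nonempty) (hbdd : BddAbove V)
    (hlower : ∀ e ∈ E, ∃ v ∈ V, 1 - v ≤ e) (hupper : ∀ v ∈ V, ∃ e ∈ E, e ≤ 1 - v) :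
    sInf E = 1 - sSup V := by
  have hE : ∀ e ∈ E, 1 - sSup V ≤ e := fun e he ↦ by
    obtain ⟨v, hv, hve⟩ := hlower e he
    linarith [le_csSup hbdd hv]
  have hEne : E.Nonempty := by
    obtain ⟨v, hv⟩ := hV
    obtain ⟨e, he, -⟩ := hupper v hv
    exact ⟨e, he⟩
  refine le_antisymm ?_ (le_csInf hEne hE)
  suffices sSup V ≤ 1 - sInf E by linarith
  refine csSup_le hV fun v hv ↦ ?_
  obtain ⟨e, he, hev⟩ := hupper v hv
  linarith [csInf_le ⟨_, hE⟩ he]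

variable {d : ℕ} {R : Party → Type*} [∀ p, DecidableEq (R p)]

theorem isSwapFamily_single_one (hd : 1 ≤ d) :
    IsSwapFamily d (Pi.single (false, false) (1 : Matrix (∀ p, R p) (∀ p, R p) ℂ)) := by
  have hone : (0 : Matrix (∀ p, R p) (∀ p, R p) ℂ) ≤ 1 := PosSemidef.one.nonneg
  have hd' : (1 : ℝ) ≤ d := mod_cast hd
  have hweight (s : ℤˣ) : 0 ≤ signWeight d s false := by
    rcases Int.units_eq_one_or s with rfl | rfl <;> simp [signWeight] <;> linarith
  have hsum (s t : ℤˣ) : ∑ x, (signWeight d s x.1 * signWeight d t x.2) •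
      (Pi.single (false, false) 1 : Bool × Bool → Matrix (∀ p, R p) (∀ p, R p) ℂ) x =
      (signWeight d s false * signWeight d t false) • 1 := by
    rw [Finset.sum_eq_single_of_mem (false, false) (Finset.mem_univ _)]
    · simp
    · intro x _ hx
      simp [hx]
  refine ⟨fun x ↦ ?_, ?_, fun p _ s t ↦ ?_, fun x ↦ ?_⟩
  · simp only [Pi.single_apply]
    split_ifs
    exacts [hone, le_rfl]
  · simp [Finset.sum_pi_single']
  · rw [hsum, LinearMap.map_smul_of_tower, partialTranspose_one]
    exact (PosSemidef.one.smul (mul_nonneg (hweight s) (hweight t))).nonneg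
  · simp only [Pi.single_apply]
    split_ifs
    · rwa [partialTranspose_one]
    · exact (map_zero _).ge

variable [∀ p, Fintype (R p)] {ρ : Matrix (∀ p, R p) (∀ p, R p) ℂ}
  {X : Bool × Bool → Matrix (∀ p, R p) (∀ p, R p) ℂ}

theorem IsSwapFamily.trace_mul_re_mem_Icc (hX : IsSwapFamily d X) (hρ : IsState ρ)
    (x : Bool × Bool) : (ρ * X x).trace.re ∈ Set.Icc 0 1 := by
  have hle : X x ≤ 1 :=
    hX.sum_eq_one ▸ Finset.single_le_sum (fun y _ ↦ hX.nonneg y) (Finset.mem_univ x)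
  have htrace := trace_mul_le_trace_mul hρ.1.nonneg hle
  rw [Matrix.mul_one, hρ.2] at htrace
  exact ⟨(Complex.le_def.1 (trace_mul_nonneg hρ.1.nonneg (hX.nonneg x))).1,
    (Complex.le_def.1 htrace).1⟩

theorem exists_swapFeasible_iff (t : ℝ) :
    (∃ K L M N : Matrix (∀ p, R p) (∀ p, R p) ℂ,
      SwapFeasible d K L M N ∧ t = (ρ * K).trace.re) ↔
    ∃ X : Bool × Bool → Matrix (∀ p, R p) (∀ p, R p) ℂ,
      IsSwapFamily d X ∧ t = (ρ * X (true, true)).trace.re := by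
  constructor
  · rintro ⟨K, L, M, N, h, rfl⟩
    let X : Bool × Bool → Matrix (∀ p, R p) (∀ p, R p) ℂ :=
      fun x ↦ cond x.1 (cond x.2 K L) (cond x.2 M N)
    exact ⟨X, (isSwapFamily_iff X).2 h, rfl⟩
  · rintro ⟨X, hX, rfl⟩
    exact ⟨_, _, _, _, (isSwapFamily_iff X).1 hX, rfl⟩

theorem sInf_error_eq_one_sub_sSup (hd : 2 ≤ d) (hρ : IsState ρ)
    (err : (Matrix (∀ p, SwapSys d p × R p) (∀ p, SwapSys d p × R p) ℂ →ₗ[ℂ]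
      Matrix (∀ p, SwapSys d p) (∀ p, SwapSys d p) ℂ) → ℝ)
    (hlower : ∀ P, IsCPPTP P → 1 - (ρ * swapEffects P (true, true)).trace.re ≤ err P)
    (hupper : ∀ X, IsSwapFamily d X →
      err (swapSimulation d X) ≤ 1 - (ρ * X (true, true)).trace.re) :
    sInf {e | ∃ P, IsCPPTP P ∧ e = err P} =
      1 - sSup {t : ℝ | ∃ K L M N : Matrix (∀ p, R p) (∀ p, R p) ℂ,
        SwapFeasible d K L M N ∧ t = (ρ * K).trace.re} := by
  simp only [exists_swapFeasible_iff]
  refine csInf_eq_one_sub_csSup ⟨_, _, isSwapFamily_single_one (by lia), rfl⟩ ⟨1, ?_⟩ ?_ ?_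
  · rintro _ ⟨X, hX, rfl⟩
    exact (hX.trace_mul_re_mem_Icc hρ _).2
  · rintro _ ⟨P, hP, rfl⟩
    exact ⟨_, ⟨_, isSwapFamily_swapEffects hd hP, rfl⟩, hlower P hP⟩
  · rintro _ ⟨X, hX, rfl⟩
    exact ⟨_, ⟨_, hX.isCPPTP_swapSimulation hd, rfl⟩, hupper X hX⟩

theorem nonempty_swapSys [NeZero d] : Nonempty (∀ p, SwapSys d p) :=
  Fintype.card_pos_iff.1 (card_swapSys (d := d) ▸ pow_pos (NeZero.pos d) 2)

theorem isChannel_swapChannel (hd : 2 ≤ d) : IsChannel (swapChannel d) := by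
  have : NeZero d := ⟨by lia⟩
  exact isotropicSwap_true (d := d) ▸ isChannel_isotropicSwap hd _

theorem pptError_swapChannel (hd : 2 ≤ d) (hρ : IsState ρ) :
    pptError (swapChannel d) ρ =
      1 - sSup {t : ℝ | ∃ K L M N : Matrix (∀ p, R p) (∀ p, R p) ℂ,
        SwapFeasible d K L M N ∧ t = (ρ * K).trace.re} := by
  have : NeZero d := ⟨by lia⟩
  have := nonempty_swapSys (d := d)
  refine sInf_error_eq_one_sub_sSup hd hρ _ (fun P hP ↦ ?_) fun X hX ↦ ?_
  · rw [trace_mul_swapEffects]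
    exact one_sub_trace_choi_mul_le_half_diamondDist (isChannel_swapChannel hd)
      (hP.1.comp (isChannel_tensorResource hρ)) choi_swapChannel
  · have hdist := diamondDist_le (isChannel_swapChannel hd)
      ((hX.isChannel_swapSimulation hd).comp (isChannel_tensorResource hρ))
      (hX.trace_mul_re_mem_Icc hρ _).2 (hX.isCP_swapSimulation_sub hd hρ)
    linarith

theorem pptErrorF_swapChannel (hd : 2 ≤ d) (hρ : IsState ρ) :
    pptErrorF (swapChannel d) ρ =
      1 - sSup {t : ℝ | ∃ K L M N : Matrix (∀ p, R p) (∀ p, R p) ℂ,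
        SwapFeasible d K L M N ∧ t = (ρ * K).trace.re} := by
  have : NeZero d := ⟨by lia⟩
  have := nonempty_swapSys (d := d)
  refine sInf_error_eq_one_sub_sSup hd hρ _ (fun P hP ↦ ?_) fun X hX ↦ ?_
  · rw [trace_mul_swapEffects]
    exact sub_le_sub_left (channelFidelity_le_trace_choi_mul (isChannel_swapChannel hd)
      (hP.1.comp (isChannel_tensorResource hρ)) choi_swapChannel) 1
  · exact sub_le_sub_left (le_channelFidelity (isChannel_swapChannel hd)
      (hX.trace_mul_re_mem_Icc hρ _).1 (hX.isCP_swapSimulation_sub hd hρ)) 1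

end Value

end QChannel

end

theorem mainTheorem9 (d : ℕ) (hd : 2 ≤ d) {R : Party → Type*} [∀ p, Fintype (R p)]
    [∀ p, DecidableEq (R p)] (ρ : Matrix (∀ p, R p) (∀ p, R p) ℂ) (hρ : IsState ρ) :
    pptError (swapChannel d) ρ = pptErrorF (swapChannel d) ρ ∧
    pptErrorF (swapChannel d) ρ =
      1 - sSup {t : ℝ | ∃ K L M N : Matrix (∀ p, R p) (∀ p, R p) ℂ,
        SwapFeasible d K L M N ∧ t = (ρ * K).trace.re} :=
  ⟨(pptError_swapChannel hd hρ).trans (pptErrorF_swapChannel hd hρ).symm,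
    pptErrorF_swapChannel hd hρ⟩
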